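/- Let $k$ be a field, $q\in k\setminus\{0\}$, $m,n\in\mathbb N$, $A=k[x]$, $B=k[y]$, $E=A^m$, $F=B^n$, with canonical generators $e_1,\dots,e_m$ of $E$ and $f_1,\dots,f_n$ of $F$. All connections are right connections, and $\Omega^1A$, $\Omega^1B$ are the bimodules of universal one-forms, with differential $d$. Let $R:B\otimes A\to A\otimes B$, $R(y^i\otimes x^j)=q^{ij}\,x^j\otimes y^i$, be the invertible twisting map extending $R(y\otimes x)=q\,x\otimes y$, so that $k_q[x,y]=A\otimes_RB$, and let $\tau:F\otimes A\to A\otimes F$ be the invertible module twisting map that applies $R$ in each component, with inverse $\sigma$. Let $\widetilde R$ be the lift of $R$ to one-forms, determined by $\widetilde R\circ(d\otimes A)=(A\otimes d)\circ R$ and $\widetilde R\circ(B\otimes d)=(d\otimes B)\circ R$. For connections $\nabla^E:E\to E\otimes_A\Omega^1A$ and $\nabla^F:F\to F\otimes_B\Omega^1B$, with $\nabla^E(e)=\sum_r e_r'\otimes\mu_r$ and $\nabla^F(f)=\sum_r f_r'\otimes\nu_r$, their product is the linear map $$\nabla:E\otimes B\oplus A\otimes F\to(E\otimes B\oplus A\otimes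 F)\otimes_{A\otimes_RB}(\Omega^1A\otimes B\oplus A\otimes\Omega^1B),$$ $$\nabla(e\otimes b,a\otimes f)=\sum_r e_r'\otimes1\otimes\mu_r\otimes b+e\otimes1\otimes1\otimes db+\sum_r a\otimes f_r'\otimes1\otimes\nu_r+\sum 1\otimes f_\sigma\otimes d(a_\sigma)\otimes1,$$ where $\sigma(a\otimes f)=\sum f_\sigma\otimes a_\sigma$. Call $\nabla^F$ compatible with $\tau$ if $(A\otimes\nabla^F)\circ\tau=(\tau\otimes\Omega^1B)\circ(F\otimes\widetilde R)\circ(\nabla^F\otimes A)$. Let $\nabla_0^E(a_1,\dots,a_m)=\sum_ie_i\otimes da_i$ and $\nabla_0^F(b_1,\dots,b_n)=\sum_lf_l\otimes db_l$ be the Grassmann connections, and let $\nabla^{gr}$ be their product. Write $\lambda_c(p(y))=p(cy)$, applied componentwise on $F$. Then: 1. $\nabla_0^E$ and $\nabla_0^F$ are connections, $\nabla_0^F$ is compatible with $\tau$, and for $e=(a_1,\dots,a_m)\in E$, $b\in B$, $j\ge0$ and $f=(b_1,\dots,b_n)\in F$, $$\nabla^{gr}(e\otimes b,x^j\otimes f)=\sum_ie_i\otimes1\otimes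 da_i\otimes b+e\otimes1\otimes1\otimes db+\sum_lx^j\otimes f_l\otimes1\otimes db_l+1\otimes\lambda_{q^{-j}}(f)\otimes d(x^j)\otimes1.$$ In particular, for $j=1$ and $f=(y^{i_1},\dots,y^{i_n})$ the last term is $1\otimes(q^{-i_1}y^{i_1},\dots,q^{-i_n}y^{i_n})\otimes dx\otimes1$. 2. For finitely many $\varphi_i\in\mathrm{End}_A(E)$ and $\omega_i\in\Omega^1A$, let the gauge potential $\alpha^E=\sum_i\varphi_i\otimes\omega_i$ act as a matrix of one-forms, $\alpha^E(a_1,\dots,a_m)=\sum_{i,j}\varphi_i(e_j)\otimes\omega_ia_j$. Then $\nabla^E_0+\alpha^E$ is a connection on $E$, and every connection $\nabla^E$ on $E$ has this form. In the same way the connections on $F$ are exactly the maps $\nabla^F_0+\alpha^F$, with $\alpha^F(b_1,\dots,b_n)=\sum_{r,l}\psi_r(f_l)\otimes\eta_rb_l$ for finitely many $\psi_r\in\mathrm{End}_B(F)$ and $\eta_r\in\Omega^1B$. 3. Let $\nabla$ be the product of connections $\nabla^E=\nabla^E_0+\alpha^E$ and $\nabla^F=\nabla^F_0+\alpha^F$,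 with $\alpha^E$ and $\alpha^F$ as in 2. If $\nabla^F$ is compatible with $\tau$, then $\nabla$ is a right connection on the $k_q[x,y]$-module $E\otimes B\oplus A\otimes F$. In all cases, for $e=(a_1,\dots,a_m)\in E$, $b\in B$, $a\in A$ and $f=(b_1,\dots,b_n)\in F$, $$\nabla(e\otimes b,a\otimes f)=\nabla^{gr}(e\otimes b,a\otimes f)+\sum_{i,j}\varphi_i(e_j)\otimes1\otimes\omega_ia_j\otimes b+\sum_{r,l}a\otimes\psi_r(f_l)\otimes1\otimes\eta_rb_l.$$ -/

import Mathlib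

open scoped TensorProduct Polynomial

namespace ProdConn

section Forms

variable (k : Type*) [Field k] (A : Type*) [Ring A] [Algebra k A]

/-- The quotient space `A / k·1`. -/
def Bar : Type _ := A ⧸ Submodule.span k {(1 : A)}

noncomputable instance : AddCommGroup (Bar k A) :=
  inferInstanceAs (AddCommGroup (A ⧸ Submodule.span k {(1 : A)}))

noncomputable instance : Module k (Bar k A) :=
  inferInstanceAs (Module k (A ⧸ Submodule.span k {(1 : A)}))

/-- The class `[a]` of `a` in `A / k·1`. -/
noncomputable def Bar.mk : A →ₗ[k] Bar k A := Submodule.mkQ (Submodule.span k {(1 : A)})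

theorem Bar.mk_surjective : Function.Surjective (Bar.mk k A) := Submodule.mkQ_surjective _

theorem Bar.mk_one : Bar.mk k A 1 = 0 :=
  (Submodule.Quotient.mk_eq_zero _).2 (Submodule.mem_span_singleton_self _)

/-- The linear map on `A / k·1` induced by a linear map on `A` that vanishes at `1`. -/
noncomputable def Bar.lift {P : Type*} [AddCommGroup P] [Module k P] (g : A →ₗ[k] P)
    (hg : g 1 = 0) : Bar k A →ₗ[k] P :=
  Submodule.liftQ (Submodule.span k {(1 : A)}) g (by
    rwa [Submodule.span_singleton_le_iff_mem, LinearMap.mem_ker])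

@[simp] theorem Bar.lift_mk {P : Type*} [AddCommGroup P] [Module k P] (g : A →ₗ[k] P)
    (hg : g 1 = 0) (a : A) : Bar.lift k A g hg (Bar.mk k A a) = g a := rfl

/-- The universal one-forms of `A`, in the form `A ⊗ (A / k·1)`;
the tensor `a₀ ⊗ [a₁]` is the form `a₀ d a₁`. -/
abbrev Omega : Type _ := A ⊗[k] Bar k A

/-- The universal differential `d a = 1 ⊗ [a]`. -/
noncomputable def dU : A →ₗ[k] Omega k A :=
  TensorProduct.mk k A (Bar k A) 1 ∘ₗ Bar.mk k A

/-- The left action `a · (a₀ d a₁) = (a a₀) d a₁`. -/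
noncomputable def omegaL : A ⊗[k] Omega k A →ₗ[k] Omega k A :=
  (LinearMap.mul' k A).rTensor (Bar k A) ∘ₗ (TensorProduct.assoc k A A (Bar k A)).symm.toLinearMap

@[simp] theorem omegaL_tmul (a a₀ : A) (c : Bar k A) :
    omegaL k A (a ⊗ₜ (a₀ ⊗ₜ c)) = (a * a₀) ⊗ₜ c := by
  simp [omegaL]

theorem dU_apply (a : A) : dU k A a = 1 ⊗ₜ[k] Bar.mk k A a := rfl

theorem dU_one : dU k A 1 = 0 := by
  rw [dU_apply, Bar.mk_one, TensorProduct.tmul_zero]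

/-- The bilinear map `(a₁, a) ↦ d (a₁ a) - a₁ d a`. -/
noncomputable def dMulAux : A →ₗ[k] A →ₗ[k] Omega k A :=
  LinearMap.mk₂ k (fun a₁ a => dU k A (a₁ * a) - omegaL k A (a₁ ⊗ₜ dU k A a))
    (fun _ _ _ => by simp only [add_mul, map_add, TensorProduct.add_tmul]; abel)
    (fun _ _ _ => by simp only [smul_mul_assoc, map_smul, ← TensorProduct.smul_tmul', smul_sub])
    (fun _ _ _ => by simp only [mul_add, map_add, TensorProduct.tmul_add]; abel)
    (fun _ _ _ => by simp only [mul_smul_comm, map_smul, TensorProduct.tmul_smul, smul_sub])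

theorem dMulAux_one : dMulAux k A 1 = 0 := by
  refine LinearMap.ext fun a => ?_
  simp [dMulAux, dU_apply]

/-- The map `[a₁] ⊗ a ↦ (d a₁) · a = d (a₁ a) - a₁ d a`. -/
noncomputable def dMul : Bar k A ⊗[k] A →ₗ[k] Omega k A :=
  TensorProduct.lift (Bar.lift k A (P := A →ₗ[k] Omega k A) (dMulAux k A) (dMulAux_one k A))

/-- The right action `(a₀ d a₁) · a = a₀ (d (a₁ a) - a₁ d a)`. -/
noncomputable def omegaR : Omega k A ⊗[k] A →ₗ[k] Omega k A :=
  omegaL k A ∘ₗ (dMul k A).lTensor A ∘ₗ (TensorProduct.assoc k A (Bar k A) A).toLinearMap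

@[simp] theorem omegaR_tmul (a₀ a₁ a : A) :
    omegaR k A ((a₀ ⊗ₜ Bar.mk k A a₁) ⊗ₜ a) =
      a₀ ⊗ₜ Bar.mk k A (a₁ * a) - (a₀ * a₁) ⊗ₜ Bar.mk k A a := by
  simp [omegaR, dMul, dMulAux, dU_apply, TensorProduct.tmul_sub, map_sub]

theorem omega_bimodule :
    omegaR k A ∘ₗ (omegaL k A).rTensor A =
      omegaL k A ∘ₗ (omegaR k A).lTensor A ∘ₗ
        (TensorProduct.assoc k A (Omega k A) A).toLinearMap := by
  refine TensorProduct.ext_threefold fun a ω a' => ?_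
  induction ω using TensorProduct.induction_on with
  | zero => simp
  | add x y hx hy =>
    simp only [TensorProduct.tmul_add, TensorProduct.add_tmul, map_add, hx, hy]
  | tmul a₀ c =>
    obtain ⟨a₁, rfl⟩ := Bar.mk_surjective k A c
    simp [TensorProduct.tmul_sub, map_sub, mul_assoc]

end Forms

section Balanced

variable {k : Type*} [Field k] {M S N : Type*} [AddCommGroup M] [Module k M]
  [AddCommMonoid S] [Module k S] [AddCommMonoid N] [Module k N]

/-- The tensor product `M ⊗_S N`, for a right action `ρ` of `S` on `M` and a left action `l` of
`S` on `N`: the quotient of `M ⊗ N` by the elements `m s ⊗ n - m ⊗ s n`. -/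
def Bal (ρ : M ⊗[k] S →ₗ[k] M) (l : S ⊗[k] N →ₗ[k] N) : Type _ :=
  (M ⊗[k] N) ⧸ LinearMap.range
    (ρ.rTensor N - l.lTensor M ∘ₗ (TensorProduct.assoc k M S N).toLinearMap)

variable (ρ : M ⊗[k] S →ₗ[k] M) (l : S ⊗[k] N →ₗ[k] N)

noncomputable instance : AddCommGroup (Bal ρ l) :=
  inferInstanceAs (AddCommGroup ((M ⊗[k] N) ⧸ LinearMap.range
    (ρ.rTensor N - l.lTensor M ∘ₗ (TensorProduct.assoc k M S N).toLinearMap)))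

noncomputable instance : Module k (Bal ρ l) :=
  inferInstanceAs (Module k ((M ⊗[k] N) ⧸ LinearMap.range
    (ρ.rTensor N - l.lTensor M ∘ₗ (TensorProduct.assoc k M S N).toLinearMap)))

/-- The projection `m ⊗ n ↦ m ⊗_S n`. -/
noncomputable def Bal.mk : M ⊗[k] N →ₗ[k] Bal ρ l :=
  Submodule.mkQ (LinearMap.range
    (ρ.rTensor N - l.lTensor M ∘ₗ (TensorProduct.assoc k M S N).toLinearMap))

theorem Bal.mk_surjective : Function.Surjective (Bal.mk ρ l) := Submodule.mkQ_surjective _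

theorem Bal.mk_balanced : Bal.mk ρ l ∘ₗ ρ.rTensor N =
    Bal.mk ρ l ∘ₗ l.lTensor M ∘ₗ (TensorProduct.assoc k M S N).toLinearMap := by
  rw [← sub_eq_zero, ← LinearMap.comp_sub]
  refine LinearMap.ext fun z => ?_
  exact (Submodule.Quotient.mk_eq_zero _).2 ⟨z, rfl⟩

/-- The linear map induced on `M ⊗_S N` by a balanced linear map on `M ⊗ N`. -/
noncomputable def Bal.lift {P : Type*} [AddCommGroup P] [Module k P] (g : M ⊗[k] N →ₗ[k] P)
    (hg : g ∘ₗ ρ.rTensor N = g ∘ₗ l.lTensor M ∘ₗ (TensorProduct.assoc k M S N).toLinearMap) :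
    Bal ρ l →ₗ[k] P :=
  Submodule.liftQ (LinearMap.range
    (ρ.rTensor N - l.lTensor M ∘ₗ (TensorProduct.assoc k M S N).toLinearMap)) g (by
    rw [LinearMap.range_le_ker_iff, LinearMap.comp_sub, hg, sub_self])

theorem Bal.lift_mk {P : Type*} [AddCommGroup P] [Module k P] (g : M ⊗[k] N →ₗ[k] P)
    (hg : g ∘ₗ ρ.rTensor N = g ∘ₗ l.lTensor M ∘ₗ (TensorProduct.assoc k M S N).toLinearMap)
    (z : M ⊗[k] N) : Bal.lift ρ l g hg (Bal.mk ρ l z) = g z := rfl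

/-- The right action of `S` on `M ⊗_S N` induced by a right action `r` on the bimodule `N`. -/
noncomputable def Bal.act (r : N ⊗[k] S →ₗ[k] N)
    (h : r ∘ₗ l.rTensor S = l ∘ₗ r.lTensor S ∘ₗ (TensorProduct.assoc k S N S).toLinearMap)
    (s : S) : Bal ρ l →ₗ[k] Bal ρ l :=
  Bal.lift ρ l (Bal.mk ρ l ∘ₗ LinearMap.lTensor M (r ∘ₗ (TensorProduct.mk k N S).flip s)) (by
    refine TensorProduct.ext_threefold fun m t n => ?_
    have h1 := LinearMap.congr_fun h ((t ⊗ₜ n) ⊗ₜ s)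
    have h2 := LinearMap.congr_fun (Bal.mk_balanced ρ l) ((m ⊗ₜ t) ⊗ₜ (r (n ⊗ₜ s)))
    simp only [LinearMap.coe_comp, Function.comp_apply, LinearMap.rTensor_tmul,
      LinearMap.lTensor_tmul, LinearEquiv.coe_coe, TensorProduct.assoc_tmul,
      LinearMap.flip_apply, TensorProduct.mk_apply] at h1 h2 ⊢
    rw [h1, h2])

end Balanced
section Middle

variable {k : Type*} [Field k] {X P Q Y Z W : Type*} [AddCommGroup X] [Module k X]
  [AddCommGroup P] [Module k P] [AddCommGroup Q] [Module k Q] [AddCommGroup Y] [Module k Y]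
  [AddCommGroup Z] [Module k Z] [AddCommGroup W] [Module k W]

/-- The composite `(f ⊗ g) ∘ (X ⊗ t ⊗ Y)`, that is
`(x ⊗ u) ⊗ (p ⊗ y) ↦ f (x ⊗ p_t) ⊗ g (u_t ⊗ y)` where `t (u ⊗ p) = p_t ⊗ u_t`. -/
noncomputable def twAct (f : X ⊗[k] P →ₗ[k] Z) (g : Q ⊗[k] Y →ₗ[k] W)
    (t : Q ⊗[k] P →ₗ[k] P ⊗[k] Q) : (X ⊗[k] Q) ⊗[k] (P ⊗[k] Y) →ₗ[k] Z ⊗[k] W :=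
  TensorProduct.map f g ∘ₗ
  (TensorProduct.assoc k X P (Q ⊗[k] Y)).symm.toLinearMap ∘ₗ
  ((TensorProduct.assoc k P Q Y).toLinearMap ∘ₗ t.rTensor Y ∘ₗ
    (TensorProduct.assoc k Q P Y).symm.toLinearMap).lTensor X ∘ₗ
  (TensorProduct.assoc k X Q (P ⊗[k] Y)).toLinearMap

theorem twAct_tmul (f : X ⊗[k] P →ₗ[k] Z) (g : Q ⊗[k] Y →ₗ[k] W)
    (t : Q ⊗[k] P →ₗ[k] P ⊗[k] Q) (x : X) (u : Q) (p : P) (y : Y) :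
    twAct f g t ((x ⊗ₜ u) ⊗ₜ (p ⊗ₜ y)) =
      TensorProduct.map (f ∘ₗ TensorProduct.mk k X P x)
        (g ∘ₗ (TensorProduct.mk k Q Y).flip y) (t (u ⊗ₜ p)) := by
  simp only [twAct, LinearMap.comp_apply, LinearEquiv.coe_coe, TensorProduct.assoc_tmul,
    LinearMap.lTensor_tmul, TensorProduct.assoc_symm_tmul, LinearMap.rTensor_tmul]
  generalize t (u ⊗ₜ p) = v
  induction v using TensorProduct.induction_on with
  | zero => simp
  | add v w hv hw => simp only [TensorProduct.tmul_add, TensorProduct.add_tmul, map_add, hv, hw]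
  | tmul a c => simp

end Middle

section Twist

variable {k : Type*} [Field k] {A B : Type*} [Ring A] [Algebra k A] [Ring B] [Algebra k B]
variable {X Y : Type*} [AddCommGroup X] [Module k X] [AddCommGroup Y] [Module k Y]
variable (R : B ⊗[k] A →ₗ[k] A ⊗[k] B)

/-- The condition `t ∘ (l ⊗ A) = (A ⊗ l) ∘ (R ⊗ Y) ∘ (B ⊗ t)` on `t : Y ⊗ A → A ⊗ Y`, where
`l` is a left action of `B` on `Y`. -/
def LeftHex (l : B ⊗[k] Y →ₗ[k] Y) (t : Y ⊗[k] A →ₗ[k] A ⊗[k] Y) : Prop :=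
  t ∘ₗ l.rTensor A = l.lTensor A ∘ₗ (TensorProduct.assoc k A B Y).toLinearMap ∘ₗ
    R.rTensor Y ∘ₗ (TensorProduct.assoc k B A Y).symm.toLinearMap ∘ₗ t.lTensor B ∘ₗ
    (TensorProduct.assoc k B Y A).toLinearMap

/-- The condition `t ∘ (B ⊗ r) = (r ⊗ B) ∘ (X ⊗ R) ∘ (t ⊗ A)` on `t : B ⊗ X → X ⊗ B`, where
`r` is a right action of `A` on `X`. -/
def RightHex (r : X ⊗[k] A →ₗ[k] X) (t : B ⊗[k] X →ₗ[k] X ⊗[k] B) : Prop :=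
  t ∘ₗ r.lTensor B = r.rTensor B ∘ₗ (TensorProduct.assoc k X A B).symm.toLinearMap ∘ₗ
    R.lTensor X ∘ₗ (TensorProduct.assoc k X B A).toLinearMap ∘ₗ t.rTensor A ∘ₗ
    (TensorProduct.assoc k B X A).symm.toLinearMap

variable {R}

theorem tw_bimodule {lX : A ⊗[k] X →ₗ[k] X} {rX : X ⊗[k] A →ₗ[k] X}
    {lY : B ⊗[k] Y →ₗ[k] Y} {rY : Y ⊗[k] B →ₗ[k] Y}
    {t : B ⊗[k] X →ₗ[k] X ⊗[k] B} {t' : Y ⊗[k] A →ₗ[k] A ⊗[k] Y}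
    (hX : rX ∘ₗ lX.rTensor A = lX ∘ₗ rX.lTensor A ∘ₗ (TensorProduct.assoc k A X A).toLinearMap)
    (hY : rY ∘ₗ lY.rTensor B = lY ∘ₗ rY.lTensor B ∘ₗ (TensorProduct.assoc k B Y B).toLinearMap)
    (ht : RightHex R rX t) (ht' : LeftHex R lY t') :
    twAct rX rY t' ∘ₗ (twAct lX lY t).rTensor (A ⊗[k] B) =
      twAct lX lY t ∘ₗ (twAct rX rY t').lTensor (A ⊗[k] B) ∘ₗ
        (TensorProduct.assoc k (A ⊗[k] B) (X ⊗[k] Y) (A ⊗[k] B)).toLinearMap := by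
  have hX' : ∀ a x a', rX (lX (a ⊗ₜ x) ⊗ₜ a') = lX (a ⊗ₜ rX (x ⊗ₜ a')) := fun a x a' => by
    simpa using LinearMap.congr_fun hX ((a ⊗ₜ x) ⊗ₜ a')
  have hY' : ∀ a x a', rY (lY (a ⊗ₜ x) ⊗ₜ a') = lY (a ⊗ₜ rY (x ⊗ₜ a')) := fun a x a' => by
    simpa using LinearMap.congr_fun hY ((a ⊗ₜ x) ⊗ₜ a')
  refine TensorProduct.ext_threefold fun s n s' => ?_
  simp only [LinearMap.comp_apply, LinearEquiv.coe_coe, TensorProduct.assoc_tmul,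
    LinearMap.lTensor_tmul, LinearMap.rTensor_tmul]
  induction s using TensorProduct.induction_on with
  | zero => simp
  | add u v hu hv => simp only [TensorProduct.add_tmul, map_add, hu, hv]
  | tmul α β =>
  induction s' using TensorProduct.induction_on with
  | zero => simp
  | add u v hu hv => simp only [TensorProduct.tmul_add, map_add, hu, hv]
  | tmul α' β' =>
  induction n using TensorProduct.induction_on with
  | zero => simp
  | add u v hu hv => simp only [TensorProduct.tmul_add, TensorProduct.add_tmul, map_add, hu, hv]
  | tmul x y =>
  rw [twAct_tmul, twAct_tmul]
  have e1 : ∀ b a', t (b ⊗ₜ rX (x ⊗ₜ a')) = _ := fun b a' =>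
    LinearMap.congr_fun ht (b ⊗ₜ (x ⊗ₜ a'))
  have e2 : ∀ b a', t' (lY (b ⊗ₜ y) ⊗ₜ a') = _ := fun b a' =>
    LinearMap.congr_fun ht' ((b ⊗ₜ y) ⊗ₜ a')
  simp only [LinearMap.comp_apply, LinearEquiv.coe_coe, TensorProduct.assoc_tmul,
    LinearMap.lTensor_tmul, LinearMap.rTensor_tmul, TensorProduct.assoc_symm_tmul] at e1 e2
  -- both sides are values of one map at `t (β ⊗ x)` and `t' (y ⊗ α')`
  let f : X ⊗[k] A →ₗ[k] X := lX ∘ₗ TensorProduct.mk k A X α ∘ₗ rX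
  let g : B ⊗[k] Y →ₗ[k] Y := rY ∘ₗ (TensorProduct.mk k Y B).flip β' ∘ₗ lY
  have key1 : ∀ u : X ⊗[k] B,
      twAct rX rY t' (TensorProduct.map (lX ∘ₗ TensorProduct.mk k A X α)
        (lY ∘ₗ (TensorProduct.mk k B Y).flip y) u ⊗ₜ (α' ⊗ₜ β')) =
      twAct f g R (u ⊗ₜ t' (y ⊗ₜ α')) := by
    intro u
    induction u using TensorProduct.induction_on with
    | zero => simp
    | add u v hu hv => simp only [TensorProduct.add_tmul, map_add, hu, hv]
    | tmul x' b' =>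
    simp only [TensorProduct.map_tmul, LinearMap.comp_apply, TensorProduct.mk_apply,
      LinearMap.flip_apply]
    rw [twAct_tmul, e2]
    generalize t' (y ⊗ₜ α') = v
    induction v using TensorProduct.induction_on with
    | zero => simp
    | add u v hu hv => simp only [TensorProduct.tmul_add, map_add, hu, hv]
    | tmul a' y' =>
    rw [twAct_tmul, TensorProduct.assoc_symm_tmul, LinearMap.rTensor_tmul]
    generalize R (b' ⊗ₜ a') = w
    induction w using TensorProduct.induction_on with
    | zero => simp
    | add u v hu hv => simp only [TensorProduct.add_tmul, map_add, hu, hv]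
    | tmul a'' b'' => simp [f, g, hX']
  have key2 : ∀ v : A ⊗[k] Y,
      twAct lX lY t ((α ⊗ₜ β) ⊗ₜ TensorProduct.map (rX ∘ₗ TensorProduct.mk k X A x)
        (rY ∘ₗ (TensorProduct.mk k Y B).flip β') v) =
      twAct f g R (t (β ⊗ₜ x) ⊗ₜ v) := by
    intro v
    induction v using TensorProduct.induction_on with
    | zero => simp
    | add u v hu hv => simp only [TensorProduct.tmul_add, map_add, hu, hv]
    | tmul a' y' =>
    simp only [TensorProduct.map_tmul, LinearMap.comp_apply, TensorProduct.mk_apply,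
      LinearMap.flip_apply]
    rw [twAct_tmul, e1]
    generalize t (β ⊗ₜ x) = u
    induction u using TensorProduct.induction_on with
    | zero => simp
    | add u v hu hv => simp only [TensorProduct.add_tmul, map_add, hu, hv]
    | tmul x' b' =>
    rw [twAct_tmul, TensorProduct.assoc_tmul, LinearMap.lTensor_tmul]
    generalize R (b' ⊗ₜ a') = w
    induction w using TensorProduct.induction_on with
    | zero => simp
    | add u v hu hv => simp only [TensorProduct.tmul_add, map_add, hu, hv]
    | tmul a'' b'' => simp [f, g, hY']
  rw [key1, key2]

variable (k A B) in
/-- An invertible twisting map `R : B ⊗ A → A ⊗ B`. -/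
structure TwistingMap where
  /-- The underlying bijective linear map. -/
  toEquiv : B ⊗[k] A ≃ₗ[k] A ⊗[k] B
  one_right : ∀ b : B, toEquiv (b ⊗ₜ 1) = 1 ⊗ₜ b
  one_left : ∀ a : A, toEquiv (1 ⊗ₜ a) = a ⊗ₜ 1
  mul_right : toEquiv.toLinearMap ∘ₗ (LinearMap.mul' k A).lTensor B =
    (LinearMap.mul' k A).rTensor B ∘ₗ (TensorProduct.assoc k A A B).symm.toLinearMap ∘ₗ
      toEquiv.toLinearMap.lTensor A ∘ₗ (TensorProduct.assoc k A B A).toLinearMap ∘ₗ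
      toEquiv.toLinearMap.rTensor A ∘ₗ (TensorProduct.assoc k B A A).symm.toLinearMap
  mul_left : toEquiv.toLinearMap ∘ₗ (LinearMap.mul' k B).rTensor A =
    (LinearMap.mul' k B).lTensor A ∘ₗ (TensorProduct.assoc k A B B).toLinearMap ∘ₗ
      toEquiv.toLinearMap.rTensor B ∘ₗ (TensorProduct.assoc k B A B).symm.toLinearMap ∘ₗ
      toEquiv.toLinearMap.lTensor B ∘ₗ (TensorProduct.assoc k B B A).toLinearMap

namespace TwistingMap

variable (T : TwistingMap k A B)

/-- The twisting map as a linear map. -/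
def map : B ⊗[k] A →ₗ[k] A ⊗[k] B := T.toEquiv.toLinearMap

theorem map_one_right (b : B) : T.map (b ⊗ₜ 1) = 1 ⊗ₜ b := T.one_right b

theorem map_one_left (a : A) : T.map (1 ⊗ₜ a) = a ⊗ₜ 1 := T.one_left a

theorem rightHex_mul : RightHex T.map (LinearMap.mul' k A) T.map := T.mul_right

theorem leftHex_mul : LeftHex T.map (LinearMap.mul' k B) T.map := T.mul_left

/-- The multiplication `(a ⊗ b)(a' ⊗ b') = a a'_R ⊗ b_R b'` of the twisted tensor product
`A ⊗_R B`. -/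
noncomputable def mul : (A ⊗[k] B) ⊗[k] (A ⊗[k] B) →ₗ[k] A ⊗[k] B :=
  twAct (LinearMap.mul' k A) (LinearMap.mul' k B) T.map

/-- The map `B ⊗ (A / k·1) → (A / k·1) ⊗ B` induced by `R`. -/
noncomputable def barA : B ⊗[k] Bar k A →ₗ[k] Bar k A ⊗[k] B :=
  TensorProduct.lift (LinearMap.flip (Bar.lift k A (P := B →ₗ[k] Bar k A ⊗[k] B)
    (TensorProduct.curry ((Bar.mk k A).rTensor B ∘ₗ T.map)).flip (by
      refine LinearMap.ext fun b => ?_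
      simp [map_one_right, Bar.mk_one])))

@[simp] theorem barA_tmul (b : B) (a : A) :
    T.barA (b ⊗ₜ Bar.mk k A a) = (Bar.mk k A).rTensor B (T.map (b ⊗ₜ a)) := by
  simp [barA]

/-- The map `(B / k·1) ⊗ A → A ⊗ (B / k·1)` induced by `R`. -/
noncomputable def barB : Bar k B ⊗[k] A →ₗ[k] A ⊗[k] Bar k B :=
  TensorProduct.lift (Bar.lift k B (P := A →ₗ[k] A ⊗[k] Bar k B)
    (TensorProduct.curry ((Bar.mk k B).lTensor A ∘ₗ T.map)) (by
      refine LinearMap.ext fun a => ?_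
      simp [map_one_left, Bar.mk_one]))

@[simp] theorem barB_tmul (b : B) (a : A) :
    T.barB (Bar.mk k B b ⊗ₜ a) = (Bar.mk k B).lTensor A (T.map (b ⊗ₜ a)) := by
  simp [barB]

/-- The lifted twisting map `R̃ : B ⊗ Ω¹A → Ω¹A ⊗ B`,
`b ⊗ a₀ d a₁ ↦ (a₀)_R d (a₁)_r ⊗ (b_R)_r`. -/
noncomputable def omegaA : B ⊗[k] Omega k A →ₗ[k] Omega k A ⊗[k] B :=
  (TensorProduct.assoc k A (Bar k A) B).symm.toLinearMap ∘ₗ T.barA.lTensor A ∘ₗ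
    (TensorProduct.assoc k A B (Bar k A)).toLinearMap ∘ₗ T.map.rTensor (Bar k A) ∘ₗ
    (TensorProduct.assoc k B A (Bar k A)).symm.toLinearMap

/-- The lifted twisting map `R̃ : Ω¹B ⊗ A → A ⊗ Ω¹B`,
`b₀ d b₁ ⊗ a ↦ (a_R)_r ⊗ (b₀)_r d (b₁)_R`. -/
noncomputable def omegaB : Omega k B ⊗[k] A →ₗ[k] A ⊗[k] Omega k B :=
  (TensorProduct.assoc k A B (Bar k B)).toLinearMap ∘ₗ T.map.rTensor (Bar k B) ∘ₗ
    (TensorProduct.assoc k B A (Bar k B)).symm.toLinearMap ∘ₗ T.barB.lTensor B ∘ₗ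
    (TensorProduct.assoc k B (Bar k B) A).toLinearMap

theorem map_mul_right (b : B) (a a' : A) : T.map (b ⊗ₜ (a * a')) =
    (LinearMap.mul' k A).rTensor B ((TensorProduct.assoc k A A B).symm
      (T.map.lTensor A (TensorProduct.assoc k A B A (T.map (b ⊗ₜ a) ⊗ₜ a')))) := by
  simpa using LinearMap.congr_fun T.rightHex_mul (b ⊗ₜ (a ⊗ₜ a'))

theorem map_mul_left (b b' : B) (a : A) : T.map ((b * b') ⊗ₜ a) =
    (LinearMap.mul' k B).lTensor A (TensorProduct.assoc k A B B
      (T.map.rTensor B ((TensorProduct.assoc k B A B).symm (b ⊗ₜ T.map (b' ⊗ₜ a))))) := by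
  simpa using LinearMap.congr_fun T.leftHex_mul ((b ⊗ₜ b') ⊗ₜ a)

theorem rightHex_omega : RightHex T.map (omegaR k A) T.omegaA := by
  unfold RightHex
  refine LinearMap.ext fun z => ?_
  induction z using TensorProduct.induction_on with
  | zero => simp
  | add u v hu hv => simp only [map_add, hu, hv]
  | tmul b z =>
  induction z using TensorProduct.induction_on with
  | zero => simp
  | add u v hu hv => simp only [TensorProduct.tmul_add, map_add, hu, hv]
  | tmul ω a' =>
  induction ω using TensorProduct.induction_on with
  | zero => simp
  | add u v hu hv => simp only [TensorProduct.tmul_add, TensorProduct.add_tmul, map_add, hu, hv]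
  | tmul a₀ c =>
  obtain ⟨a₁, rfl⟩ := Bar.mk_surjective k A c
  simp only [LinearMap.comp_apply, LinearEquiv.coe_coe,
    LinearMap.lTensor_tmul,
    LinearMap.rTensor_tmul, TensorProduct.assoc_symm_tmul, omegaR_tmul, omegaA,
    TensorProduct.tmul_sub, map_sub]
  rw [T.map_mul_right b a₀ a₁]
  generalize T.map (b ⊗ₜ a₀) = u
  induction u using TensorProduct.induction_on with
  | zero => simp
  | add u v hu hv =>
    simp only [TensorProduct.add_tmul, map_add, ← hu, ← hv]; abel
  | tmul a c =>
  simp only [TensorProduct.assoc_tmul, LinearMap.lTensor_tmul, barA_tmul, T.map_mul_right c a₁ a']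
  generalize T.map (c ⊗ₜ a₁) = u
  induction u using TensorProduct.induction_on with
  | zero => simp
  | add u v hu hv =>
    simp only [TensorProduct.tmul_add, TensorProduct.add_tmul, map_add, ← hu, ← hv]; abel
  | tmul a₂ c₂ =>
  simp only [TensorProduct.assoc_tmul, LinearMap.lTensor_tmul, LinearMap.rTensor_tmul,
    TensorProduct.assoc_symm_tmul, LinearMap.mul'_apply, barA_tmul]
  generalize T.map (c₂ ⊗ₜ a') = u
  induction u using TensorProduct.induction_on with
  | zero => simp
  | add u v hu hv =>
    simp only [TensorProduct.tmul_add, map_add, ← hu, ← hv]; abel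
  | tmul a₃ c₃ => simp [TensorProduct.sub_tmul]

theorem leftHex_omega : LeftHex T.map (omegaL k B) T.omegaB := by
  unfold LeftHex
  refine TensorProduct.ext_threefold fun b η a => ?_
  induction η using TensorProduct.induction_on with
  | zero => simp
  | add u v hu hv => simp only [TensorProduct.tmul_add, TensorProduct.add_tmul, map_add, hu, hv]
  | tmul b₀ c =>
  simp only [LinearMap.comp_apply, LinearEquiv.coe_coe,
    TensorProduct.assoc_tmul, LinearMap.lTensor_tmul,
    LinearMap.rTensor_tmul, omegaL_tmul, omegaB]
  generalize T.barB (c ⊗ₜ a) = u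
  induction u using TensorProduct.induction_on with
  | zero => simp
  | add u v hu hv => simp only [TensorProduct.tmul_add, map_add, hu, hv]
  | tmul a₁ c₁ =>
  simp only [TensorProduct.assoc_symm_tmul, LinearMap.rTensor_tmul, T.map_mul_left]
  generalize T.map (b₀ ⊗ₜ a₁) = u
  induction u using TensorProduct.induction_on with
  | zero => simp
  | add u v hu hv => simp only [TensorProduct.tmul_add, TensorProduct.add_tmul, map_add, hu, hv]
  | tmul a₂ b₂ =>
  simp only [TensorProduct.assoc_tmul, TensorProduct.assoc_symm_tmul, LinearMap.rTensor_tmul]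
  generalize T.map (b ⊗ₜ a₂) = u
  induction u using TensorProduct.induction_on with
  | zero => simp
  | add u v hu hv => simp only [TensorProduct.add_tmul, map_add, hu, hv]
  | tmul a₃ b₃ => simp

end TwistingMap

namespace TwistingMap

variable (T : TwistingMap k A B)

/-- The one-forms `Ω¹A ⊗ B ⊕ A ⊗ Ω¹B` of the twisted tensor product `A ⊗_R B`. -/
abbrev Forms (_T : TwistingMap k A B) : Type _ := (Omega k A ⊗[k] B) × (A ⊗[k] Omega k B)

/-- The differential `d (a ⊗ b) = d a ⊗ b + a ⊗ d b`. -/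
noncomputable def dForms : A ⊗[k] B →ₗ[k] T.Forms :=
  LinearMap.prod ((dU k A).rTensor B) ((dU k B).lTensor A)

/-- The left action of `A ⊗_R B` on its one-forms. -/
noncomputable def formsL : (A ⊗[k] B) ⊗[k] T.Forms →ₗ[k] T.Forms :=
  LinearMap.prod
    (twAct (omegaL k A) (LinearMap.mul' k B) T.omegaA ∘ₗ
      (LinearMap.fst k (Omega k A ⊗[k] B) (A ⊗[k] Omega k B)).lTensor (A ⊗[k] B))
    (twAct (LinearMap.mul' k A) (omegaL k B) T.map ∘ₗ
      (LinearMap.snd k (Omega k A ⊗[k] B) (A ⊗[k] Omega k B)).lTensor (A ⊗[k] B))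

/-- The right action of `A ⊗_R B` on its one-forms. -/
noncomputable def formsR : T.Forms ⊗[k] (A ⊗[k] B) →ₗ[k] T.Forms :=
  LinearMap.prod
    (twAct (omegaR k A) (LinearMap.mul' k B) T.map ∘ₗ
      (LinearMap.fst k (Omega k A ⊗[k] B) (A ⊗[k] Omega k B)).rTensor (A ⊗[k] B))
    (twAct (LinearMap.mul' k A) (omegaR k B) T.omegaB ∘ₗ
      (LinearMap.snd k (Omega k A ⊗[k] B) (A ⊗[k] Omega k B)).rTensor (A ⊗[k] B))

theorem mul_bimodule (C : Type*) [Ring C] [Algebra k C] :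
    LinearMap.mul' k C ∘ₗ (LinearMap.mul' k C).rTensor C =
      LinearMap.mul' k C ∘ₗ (LinearMap.mul' k C).lTensor C ∘ₗ
        (TensorProduct.assoc k C C C).toLinearMap :=
  TensorProduct.ext_threefold fun a b c => by simp [mul_assoc]

theorem forms_bimodule :
    T.formsR ∘ₗ T.formsL.rTensor (A ⊗[k] B) = T.formsL ∘ₗ T.formsR.lTensor (A ⊗[k] B) ∘ₗ
      (TensorProduct.assoc k (A ⊗[k] B) T.Forms (A ⊗[k] B)).toLinearMap := by
  refine TensorProduct.ext_threefold fun s n s' => ?_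
  have h1 := LinearMap.congr_fun (tw_bimodule (omega_bimodule k A) (mul_bimodule B)
    T.rightHex_omega T.leftHex_mul) ((s ⊗ₜ n.1) ⊗ₜ s')
  have h2 := LinearMap.congr_fun (tw_bimodule (mul_bimodule A) (omega_bimodule k B)
    T.rightHex_mul T.leftHex_omega) ((s ⊗ₜ n.2) ⊗ₜ s')
  exact Prod.ext h1 h2

end TwistingMap
end Twist
section Connections

variable (k : Type*) [Field k]

/-- The right action of `A` on a right `A`-module `E`, as a linear map `E ⊗ A → E`. -/
noncomputable def rAct (A E : Type*) [Ring A] [Algebra k A] [AddCommGroup E] [Module k E]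
    [Module Aᵐᵒᵖ E] [IsScalarTower k Aᵐᵒᵖ E] : E ⊗[k] A →ₗ[k] E :=
  TensorProduct.lift (LinearMap.mk₂ k (fun e a => MulOpposite.op a • e)
    (fun _ _ _ => smul_add _ _ _)
    (fun c e a => (smul_comm c (MulOpposite.op a) e).symm)
    (fun _ _ _ => by rw [MulOpposite.op_add, add_smul])
    (fun c a e => by rw [MulOpposite.op_smul, smul_assoc]))

@[simp] theorem rAct_tmul {A E : Type*} [Ring A] [Algebra k A] [AddCommGroup E] [Module k E]
    [Module Aᵐᵒᵖ E] [IsScalarTower k Aᵐᵒᵖ E] (e : E) (a : A) :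
    rAct k A E (e ⊗ₜ a) = MulOpposite.op a • e := rfl

variable {k}

/-- `∇ : M → M ⊗_S N` is a right connection: `∇ (m s) = (∇ m) s + m ⊗ d s`. Here `ρ` is the right
action of `S` on `M`, `l` and `r` are the actions of `S` on the bimodule `N` of one-forms, and
`d : S → N` is the differential. -/
def IsConnection {M S N : Type*} [AddCommGroup M] [Module k M] [AddCommMonoid S] [Module k S]
    [AddCommMonoid N] [Module k N] (ρ : M ⊗[k] S →ₗ[k] M) (l : S ⊗[k] N →ₗ[k] N)
    (r : N ⊗[k] S →ₗ[k] N)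
    (h : r ∘ₗ l.rTensor S = l ∘ₗ r.lTensor S ∘ₗ (TensorProduct.assoc k S N S).toLinearMap)
    (d : S →ₗ[k] N) (nabla : M →ₗ[k] Bal ρ l) : Prop :=
  ∀ (m : M) (s : S), nabla (ρ (m ⊗ₜ s)) = Bal.act ρ l r h s (nabla m) + Bal.mk ρ l (m ⊗ₜ d s)

variable (k) in
/-- `E ⊗_A Ω¹A` for a right `A`-module `E`. -/
abbrev ModForms (A E : Type*) [Ring A] [Algebra k A] [AddCommGroup E] [Module k E]
    [Module Aᵐᵒᵖ E] [IsScalarTower k Aᵐᵒᵖ E] : Type _ := Bal (rAct k A E) (omegaL k A)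

/-- Universal right connections `∇ : E → E ⊗_A Ω¹A` on a right `A`-module `E`. -/
def IsUniversalConnection {A E : Type*} [Ring A] [Algebra k A] [AddCommGroup E] [Module k E]
    [Module Aᵐᵒᵖ E] [IsScalarTower k Aᵐᵒᵖ E] (nabla : E →ₗ[k] ModForms k A E) : Prop :=
  IsConnection (rAct k A E) (omegaL k A) (omegaR k A) (omega_bimodule k A) (dU k A) nabla

variable {A B : Type*} [Ring A] [Algebra k A] [Ring B] [Algebra k B]

/-- An invertible right module twisting map `τ : F ⊗ A → A ⊗ F` for a right `B`-module `F`. -/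
structure ModuleTwist (T : TwistingMap k A B) (F : Type*) [AddCommGroup F] [Module k F]
    [Module Bᵐᵒᵖ F] [IsScalarTower k Bᵐᵒᵖ F] where
  /-- The underlying bijective linear map. -/
  toEquiv : F ⊗[k] A ≃ₗ[k] A ⊗[k] F
  one_right : ∀ f : F, toEquiv (f ⊗ₜ 1) = 1 ⊗ₜ f
  mul_right : toEquiv.toLinearMap ∘ₗ (LinearMap.mul' k A).lTensor F =
    (LinearMap.mul' k A).rTensor F ∘ₗ (TensorProduct.assoc k A A F).symm.toLinearMap ∘ₗ
      toEquiv.toLinearMap.lTensor A ∘ₗ (TensorProduct.assoc k A F A).toLinearMap ∘ₗ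
      toEquiv.toLinearMap.rTensor A ∘ₗ (TensorProduct.assoc k F A A).symm.toLinearMap
  act_left : toEquiv.toLinearMap ∘ₗ (rAct k B F).rTensor A =
    (rAct k B F).lTensor A ∘ₗ (TensorProduct.assoc k A F B).toLinearMap ∘ₗ
      toEquiv.toLinearMap.rTensor B ∘ₗ (TensorProduct.assoc k F A B).symm.toLinearMap ∘ₗ
      T.map.lTensor F ∘ₗ (TensorProduct.assoc k F B A).toLinearMap

namespace ModuleTwist

variable {T : TwistingMap k A B} {F : Type*} [AddCommGroup F] [Module k F]
  [Module Bᵐᵒᵖ F] [IsScalarTower k Bᵐᵒᵖ F] (τ : ModuleTwist T F)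
  (E : Type*) [AddCommGroup E] [Module k E] [Module Aᵐᵒᵖ E] [IsScalarTower k Aᵐᵒᵖ E]

/-- The module twisting map as a linear map. -/
def map : F ⊗[k] A →ₗ[k] A ⊗[k] F := τ.toEquiv.toLinearMap

/-- The inverse `σ : A ⊗ F → F ⊗ A` of the module twisting map. -/
def inv : A ⊗[k] F →ₗ[k] F ⊗[k] A := τ.toEquiv.symm.toLinearMap

theorem map_act (f : F) (b : B) (a : A) : τ.map ((MulOpposite.op b • f) ⊗ₜ a) =
    (rAct k B F).lTensor A (TensorProduct.assoc k A F B
      (τ.map.rTensor B ((TensorProduct.assoc k F A B).symm (f ⊗ₜ T.map (b ⊗ₜ a))))) :=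
  LinearMap.congr_fun τ.act_left ((f ⊗ₜ b) ⊗ₜ a)

/-- The map `(F ⊗ Ω¹B) ⊗ A → A ⊗ (F ⊗_B Ω¹B)` given by `(τ ⊗ Ω¹B) ∘ (F ⊗ R̃)`. -/
noncomputable def passAux : (F ⊗[k] Omega k B) ⊗[k] A →ₗ[k] A ⊗[k] ModForms k B F :=
  (Bal.mk (rAct k B F) (omegaL k B)).lTensor A ∘ₗ
    (TensorProduct.assoc k A F (Omega k B)).toLinearMap ∘ₗ τ.map.rTensor (Omega k B) ∘ₗ
    (TensorProduct.assoc k F A (Omega k B)).symm.toLinearMap ∘ₗ T.omegaB.lTensor F ∘ₗ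
    (TensorProduct.assoc k F (Omega k B) A).toLinearMap

theorem passAux_balanced : TensorProduct.curry τ.passAux ∘ₗ (rAct k B F).rTensor (Omega k B) =
    TensorProduct.curry τ.passAux ∘ₗ (omegaL k B).lTensor F ∘ₗ
      (TensorProduct.assoc k F B (Omega k B)).toLinearMap := by
  refine TensorProduct.ext_threefold fun f b η => LinearMap.ext fun a => ?_
  have e : T.omegaB (omegaL k B (b ⊗ₜ η) ⊗ₜ a) = _ :=
    LinearMap.congr_fun T.leftHex_omega ((b ⊗ₜ η) ⊗ₜ a)
  simp only [LinearMap.comp_apply, LinearEquiv.coe_coe, TensorProduct.assoc_tmul,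
    LinearMap.lTensor_tmul, LinearMap.rTensor_tmul, rAct_tmul, TensorProduct.curry_apply,
    passAux] at e ⊢
  rw [e]
  generalize T.omegaB (η ⊗ₜ a) = u
  induction u using TensorProduct.induction_on with
  | zero => simp
  | add u v hu hv => simp only [TensorProduct.tmul_add, map_add, hu, hv]
  | tmul a₁ η₁ =>
  simp only [TensorProduct.assoc_symm_tmul, LinearMap.rTensor_tmul, map_act]
  generalize T.map (b ⊗ₜ a₁) = u
  induction u using TensorProduct.induction_on with
  | zero => simp
  | add u v hu hv => simp only [TensorProduct.tmul_add, TensorProduct.add_tmul, map_add, hu, hv]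
  | tmul a₂ b₂ =>
  simp only [TensorProduct.assoc_symm_tmul, TensorProduct.assoc_tmul, LinearMap.rTensor_tmul,
    LinearMap.lTensor_tmul]
  generalize τ.map (f ⊗ₜ a₂) = u
  induction u using TensorProduct.induction_on with
  | zero => simp
  | add u v hu hv => simp only [TensorProduct.add_tmul, map_add, hu, hv]
  | tmul a₃ f₃ =>
  simp only [TensorProduct.assoc_tmul, LinearMap.lTensor_tmul]
  have := LinearMap.congr_fun (Bal.mk_balanced (rAct k B F) (omegaL k B)) ((f₃ ⊗ₜ b₂) ⊗ₜ η₁)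
  simp only [LinearMap.comp_apply, LinearEquiv.coe_coe, TensorProduct.assoc_tmul,
    LinearMap.lTensor_tmul, LinearMap.rTensor_tmul] at this
  rw [this]

/-- The map `(τ ⊗ Ω¹B) ∘ (F ⊗ R̃) : (F ⊗_B Ω¹B) ⊗ A → A ⊗ (F ⊗_B Ω¹B)`. -/
noncomputable def pass : ModForms k B F ⊗[k] A →ₗ[k] A ⊗[k] ModForms k B F :=
  TensorProduct.lift (Bal.lift (rAct k B F) (omegaL k B)
    (P := A →ₗ[k] A ⊗[k] ModForms k B F) (TensorProduct.curry τ.passAux) τ.passAux_balanced)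

/-- Compatibility of `τ` with a connection on `F`:
`(A ⊗ ∇) ∘ τ = (τ ⊗ Ω¹B) ∘ (F ⊗ R̃) ∘ (∇ ⊗ A)`. -/
def Compatible (nablaF : F →ₗ[k] ModForms k B F) : Prop :=
  nablaF.lTensor A ∘ₗ τ.map = τ.pass ∘ₗ nablaF.rTensor A

/-- The space `E ⊗ B ⊕ A ⊗ F`. -/
def ProdMod (_τ : ModuleTwist T F) (E : Type*) [AddCommGroup E] [Module k E] : Type _ :=
  (E ⊗[k] B) × (A ⊗[k] F)

noncomputable instance : AddCommGroup (τ.ProdMod E) :=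
  inferInstanceAs (AddCommGroup ((E ⊗[k] B) × (A ⊗[k] F)))

noncomputable instance : Module k (τ.ProdMod E) :=
  inferInstanceAs (Module k ((E ⊗[k] B) × (A ⊗[k] F)))

/-- The identification of `E ⊗ B ⊕ A ⊗ F` with the space of pairs. -/
noncomputable def pair : ((E ⊗[k] B) × (A ⊗[k] F)) ≃ₗ[k] τ.ProdMod E :=
  LinearEquiv.refl k ((E ⊗[k] B) × (A ⊗[k] F))

/-- The right action of `A ⊗_R B` on `E ⊗ B ⊕ A ⊗ F`:
`(e ⊗ b)(α ⊗ β) = e α_R ⊗ b_R β` and `(a ⊗ f)(α ⊗ β) = a α_τ ⊗ f_τ β`. -/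
noncomputable def prodR : τ.ProdMod E ⊗[k] (A ⊗[k] B) →ₗ[k] τ.ProdMod E :=
  (τ.pair E).toLinearMap ∘ₗ LinearMap.prod
    (twAct (rAct k A E) (LinearMap.mul' k B) T.map ∘ₗ
      (LinearMap.fst k (E ⊗[k] B) (A ⊗[k] F) ∘ₗ (τ.pair E).symm.toLinearMap).rTensor (A ⊗[k] B))
    (twAct (LinearMap.mul' k A) (rAct k B F) τ.map ∘ₗ
      (LinearMap.snd k (E ⊗[k] B) (A ⊗[k] F) ∘ₗ (τ.pair E).symm.toLinearMap).rTensor (A ⊗[k] B))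

/-- The target `(E ⊗ B ⊕ A ⊗ F) ⊗_{A ⊗_R B} (Ω¹A ⊗ B ⊕ A ⊗ Ω¹B)` of a product connection. -/
abbrev Target : Type _ :=
  Bal (M := τ.ProdMod E) (S := A ⊗[k] B) (N := T.Forms) (τ.prodR E) T.formsL

/-- The projection onto the target. -/
noncomputable def toTarget : τ.ProdMod E ⊗[k] T.Forms →ₗ[k] τ.Target E :=
  Bal.mk (M := τ.ProdMod E) (S := A ⊗[k] B) (N := T.Forms) (τ.prodR E) T.formsL

/-- The class `(x, y) ⊗_{A ⊗_R B} (μ, ν)` in the target. -/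
noncomputable def cls (m : (E ⊗[k] B) × (A ⊗[k] F))
    (ν : (Omega k A ⊗[k] B) × (A ⊗[k] Omega k B)) : τ.Target E :=
  τ.toTarget E (τ.pair E m ⊗ₜ ν)

variable {E}

theorem cls_balanced (m : (E ⊗[k] B) × (A ⊗[k] F)) (s : A ⊗[k] B) (ν : T.Forms) :
    τ.cls E ((τ.pair E).symm (τ.prodR E (τ.pair E m ⊗ₜ s))) ν =
      τ.cls E m (T.formsL (s ⊗ₜ ν)) :=
  LinearMap.congr_fun (Bal.mk_balanced (M := τ.ProdMod E) (S := A ⊗[k] B) (N := T.Forms)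
    (τ.prodR E) T.formsL) ((τ.pair E m ⊗ₜ s) ⊗ₜ ν)

variable (E)

/-- The map `(e ⊗ ω) ⊗ b ↦ (e ⊗ 1) ⊗ (ω ⊗ b)`. -/
noncomputable def inclEAux : (E ⊗[k] Omega k A) ⊗[k] B →ₗ[k] τ.Target E :=
  τ.toTarget E ∘ₗ
    TensorProduct.map
      ((τ.pair E).toLinearMap ∘ₗ LinearMap.inl k (E ⊗[k] B) (A ⊗[k] F) ∘ₗ (TensorProduct.mk k E B).flip 1)
      (LinearMap.inl k (Omega k A ⊗[k] B) (A ⊗[k] Omega k B)) ∘ₗ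
    (TensorProduct.assoc k E (Omega k A) B).toLinearMap

theorem inclEAux_tmul (e : E) (ω : Omega k A) (b : B) :
    τ.inclEAux E ((e ⊗ₜ ω) ⊗ₜ b) = τ.cls E (e ⊗ₜ 1, 0) (ω ⊗ₜ b, 0) := rfl

theorem inclEAux_balanced :
    TensorProduct.curry (τ.inclEAux E) ∘ₗ (rAct k A E).rTensor (Omega k A) =
    TensorProduct.curry (τ.inclEAux E) ∘ₗ (omegaL k A).lTensor E ∘ₗ
      (TensorProduct.assoc k E A (Omega k A)).toLinearMap := by
  refine TensorProduct.ext_threefold fun e a ω => LinearMap.ext fun b => ?_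
  have h1 : (τ.pair E).symm (τ.prodR E (τ.pair E (e ⊗ₜ 1, 0) ⊗ₜ (a ⊗ₜ 1))) = ((MulOpposite.op a • e) ⊗ₜ 1, 0) := by
    refine Prod.ext ?_ ?_
    · simp [prodR, twAct_tmul, T.map_one_left]
    · simp [prodR]
  have h2 : T.formsL ((a ⊗ₜ 1) ⊗ₜ (ω ⊗ₜ b, 0)) = (omegaL k A (a ⊗ₜ ω) ⊗ₜ b, 0) := by
    refine Prod.ext ?_ ?_
    · have : T.omegaA (1 ⊗ₜ ω) = ω ⊗ₜ 1 := by
        induction ω using TensorProduct.induction_on with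
        | zero => simp
        | add u v hu hv => simp only [TensorProduct.tmul_add, TensorProduct.add_tmul, map_add, hu, hv]
        | tmul a₀ c =>
          obtain ⟨a₁, rfl⟩ := Bar.mk_surjective k A c
          simp [TwistingMap.omegaA, T.map_one_left]
      simp [TwistingMap.formsL, twAct_tmul, this]
    · simp [TwistingMap.formsL]
  have := τ.cls_balanced (e ⊗ₜ 1, 0) (a ⊗ₜ 1) (ω ⊗ₜ b, 0)
  rw [h1, h2] at this
  exact this

/-- The map `(E ⊗_A Ω¹A) ⊗ B → Target`, `(e ⊗ ω) ⊗ b ↦ (e ⊗ 1) ⊗ (ω ⊗ b)`. -/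
noncomputable def inclE : ModForms k A E ⊗[k] B →ₗ[k] τ.Target E :=
  TensorProduct.lift (Bal.lift (rAct k A E) (omegaL k A) (P := B →ₗ[k] τ.Target E)
    (TensorProduct.curry (τ.inclEAux E)) (τ.inclEAux_balanced E))

/-- The map `(f ⊗ η) ⊗ a ↦ (a ⊗ f) ⊗ (1 ⊗ η)`. -/
noncomputable def inclFAux : (F ⊗[k] Omega k B) ⊗[k] A →ₗ[k] τ.Target E :=
  τ.toTarget E ∘ₗ
    TensorProduct.map
      ((τ.pair E).toLinearMap ∘ₗ LinearMap.inr k (E ⊗[k] B) (A ⊗[k] F))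
      (LinearMap.inr k (Omega k A ⊗[k] B) (A ⊗[k] Omega k B) ∘ₗ
        TensorProduct.mk k A (Omega k B) 1) ∘ₗ
    (TensorProduct.assoc k A F (Omega k B)).symm.toLinearMap ∘ₗ
    (TensorProduct.comm k (F ⊗[k] Omega k B) A).toLinearMap

theorem inclFAux_tmul (f : F) (η : Omega k B) (a : A) :
    τ.inclFAux E ((f ⊗ₜ η) ⊗ₜ a) = τ.cls E (0, a ⊗ₜ f) (0, 1 ⊗ₜ η) := rfl

theorem inclFAux_balanced :
    TensorProduct.curry (τ.inclFAux E) ∘ₗ (rAct k B F).rTensor (Omega k B) =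
    TensorProduct.curry (τ.inclFAux E) ∘ₗ (omegaL k B).lTensor F ∘ₗ
      (TensorProduct.assoc k F B (Omega k B)).toLinearMap := by
  refine TensorProduct.ext_threefold fun f b η => LinearMap.ext fun a => ?_
  have h0 : τ.map (f ⊗ₜ 1) = 1 ⊗ₜ f := τ.one_right f
  have h1 : (τ.pair E).symm (τ.prodR E (τ.pair E (0, a ⊗ₜ f) ⊗ₜ (1 ⊗ₜ b))) = (0, a ⊗ₜ (MulOpposite.op b • f)) := by
    refine Prod.ext ?_ ?_
    · simp [prodR]
    · simp [prodR, twAct_tmul, h0]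
  have h2 : T.formsL ((1 ⊗ₜ b) ⊗ₜ (0, 1 ⊗ₜ η)) = (0, 1 ⊗ₜ omegaL k B (b ⊗ₜ η)) := by
    refine Prod.ext ?_ ?_
    · simp [TwistingMap.formsL]
    · simp [TwistingMap.formsL, twAct_tmul, T.map_one_right]
  have := τ.cls_balanced (E := E) (0, a ⊗ₜ f) (1 ⊗ₜ b) (0, 1 ⊗ₜ η)
  rw [h1, h2] at this
  exact this

/-- The map `A ⊗ (F ⊗_B Ω¹B) → Target`, `a ⊗ (f ⊗ η) ↦ (a ⊗ f) ⊗ (1 ⊗ η)`. -/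
noncomputable def inclF : A ⊗[k] ModForms k B F →ₗ[k] τ.Target E :=
  TensorProduct.lift (LinearMap.flip (Bal.lift (rAct k B F) (omegaL k B)
    (P := A →ₗ[k] τ.Target E)
    (TensorProduct.curry (τ.inclFAux E)) (τ.inclFAux_balanced E)))

variable {E}

/-- `∇₁ = (E ⊗ u_B ⊗ Ω¹A ⊗ B) ∘ (∇^E ⊗ B) + (E ⊗ u_B ⊗ u_A ⊗ Ω¹B) ∘ (E ⊗ d_B)`. -/
noncomputable def nabla₁ (nablaE : E →ₗ[k] ModForms k A E) : E ⊗[k] B →ₗ[k] τ.Target E :=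
  τ.inclE E ∘ₗ nablaE.rTensor B +
  τ.toTarget E ∘ₗ
    TensorProduct.map
      ((τ.pair E).toLinearMap ∘ₗ LinearMap.inl k (E ⊗[k] B) (A ⊗[k] F) ∘ₗ (TensorProduct.mk k E B).flip 1)
      (LinearMap.inr k (Omega k A ⊗[k] B) (A ⊗[k] Omega k B) ∘ₗ
        TensorProduct.mk k A (Omega k B) 1 ∘ₗ dU k B)

/-- `∇₂ = (A ⊗ F ⊗ u_A ⊗ Ω¹B) ∘ (A ⊗ ∇^F) + (u_A ⊗ F ⊗ d_A ⊗ u_B) ∘ σ`. -/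
noncomputable def nabla₂ (nablaF : F →ₗ[k] ModForms k B F) : A ⊗[k] F →ₗ[k] τ.Target E :=
  τ.inclF E ∘ₗ nablaF.lTensor A +
  τ.toTarget E ∘ₗ
    TensorProduct.map
      ((τ.pair E).toLinearMap ∘ₗ LinearMap.inr k (E ⊗[k] B) (A ⊗[k] F) ∘ₗ TensorProduct.mk k A F 1)
      (LinearMap.inl k (Omega k A ⊗[k] B) (A ⊗[k] Omega k B) ∘ₗ
        (TensorProduct.mk k (Omega k A) B).flip 1 ∘ₗ dU k A) ∘ₗ τ.inv

/-- The product `∇ (e ⊗ b, a ⊗ f) = ∇₁ (e ⊗ b) + ∇₂ (a ⊗ f)` of `∇^E` and `∇^F`. -/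
noncomputable def product (nablaE : E →ₗ[k] ModForms k A E) (nablaF : F →ₗ[k] ModForms k B F) :
    τ.ProdMod E →ₗ[k] τ.Target E :=
  LinearMap.coprod (τ.nabla₁ nablaE) (τ.nabla₂ nablaF) ∘ₗ (τ.pair E).symm.toLinearMap

/-- Right connections on the right `A ⊗_R B`-module `E ⊗ B ⊕ A ⊗ F`. -/
def IsTwConnection (nabla : τ.ProdMod E →ₗ[k] τ.Target E) : Prop :=
  IsConnection (M := τ.ProdMod E) (S := A ⊗[k] B) (N := T.Forms) (τ.prodR E) T.formsL T.formsR T.forms_bimodule T.dForms nabla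

end ModuleTwist
end Connections

section Free

variable (k : Type*) [Field k] (A : Type*) [Ring A] [Algebra k A]

/-- The Grassmann connection `(a₁, …, aₘ) ↦ ∑ eᵢ ⊗ d aᵢ` on the free right module `A^m`. -/
noncomputable def grassmann (m : ℕ) : (Fin m → A) →ₗ[k] ModForms k A (Fin m → A) :=
  ∑ i : Fin m, Bal.mk (rAct k A (Fin m → A)) (omegaL k A) ∘ₗ
    TensorProduct.mk k (Fin m → A) (Omega k A) (Pi.single i 1) ∘ₗ dU k A ∘ₗ LinearMap.proj i

variable {k A}

/-- The gauge potential `α = ∑ φᵢ ⊗ ωᵢ`, acting on `A^m` as a matrix of one-forms: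
`(a₁, …, aₘ) ↦ ∑ᵢⱼ φᵢ(eⱼ) ⊗ ωᵢ aⱼ`. -/
noncomputable def potential {m s : ℕ} (φ : Fin s → Module.End Aᵐᵒᵖ (Fin m → A))
    (ω : Fin s → Omega k A) : (Fin m → A) →ₗ[k] ModForms k A (Fin m → A) :=
  ∑ i : Fin s, ∑ j : Fin m, Bal.mk (rAct k A (Fin m → A)) (omegaL k A) ∘ₗ
    TensorProduct.mk k (Fin m → A) (Omega k A) (φ i (Pi.single j 1)) ∘ₗ
    omegaR k A ∘ₗ TensorProduct.mk k (Omega k A) A (ω i) ∘ₗ LinearMap.proj j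

variable {B : Type*} [Ring B] [Algebra k B]

/-- The map `B^n ⊗ A → A ⊗ B^n` that applies a linear map `B ⊗ A → A ⊗ B` in each component. -/
noncomputable def powMap (n : ℕ) (R : B ⊗[k] A →ₗ[k] A ⊗[k] B) :
    (Fin n → B) ⊗[k] A →ₗ[k] A ⊗[k] (Fin n → B) :=
  ∑ l : Fin n, (LinearMap.single k (fun _ : Fin n => B) l).lTensor A ∘ₗ R ∘ₗ
    (LinearMap.proj l : (Fin n → B) →ₗ[k] B).rTensor A

/-- The map `A ⊗ B^n → B^n ⊗ A` that applies a linear map `A ⊗ B → B ⊗ A` in each component. -/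
noncomputable def powMapInv (n : ℕ) (S : A ⊗[k] B →ₗ[k] B ⊗[k] A) :
    A ⊗[k] (Fin n → B) →ₗ[k] (Fin n → B) ⊗[k] A :=
  ∑ l : Fin n, (LinearMap.single k (fun _ : Fin n => B) l).rTensor A ∘ₗ S ∘ₗ
    (LinearMap.proj l : (Fin n → B) →ₗ[k] B).lTensor A

theorem powMap_single (n : ℕ) (R : B ⊗[k] A →ₗ[k] A ⊗[k] B) (l : Fin n) (z : B ⊗[k] A) :
    powMap n R ((LinearMap.single k (fun _ : Fin n => B) l).rTensor A z) =
      (LinearMap.single k (fun _ : Fin n => B) l).lTensor A (R z) := by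
  rw [powMap, LinearMap.sum_apply, Finset.sum_eq_single l]
  · simp only [LinearMap.comp_apply]
    rw [← LinearMap.comp_apply (LinearMap.rTensor A (LinearMap.proj l)), ← LinearMap.rTensor_comp,
      LinearMap.proj_comp_single_same, LinearMap.rTensor_id, LinearMap.id_apply]
  · intro i _ hi
    simp only [LinearMap.comp_apply]
    rw [← LinearMap.comp_apply (LinearMap.rTensor A (LinearMap.proj i)), ← LinearMap.rTensor_comp,
      LinearMap.proj_comp_single_ne _ _ _ _ hi, LinearMap.rTensor_zero]
    simp
  · simp

theorem powMapInv_single (n : ℕ) (S : A ⊗[k] B →ₗ[k] B ⊗[k] A) (l : Fin n) (z : A ⊗[k] B) :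
    powMapInv n S ((LinearMap.single k (fun _ : Fin n => B) l).lTensor A z) =
      (LinearMap.single k (fun _ : Fin n => B) l).rTensor A (S z) := by
  rw [powMapInv, LinearMap.sum_apply, Finset.sum_eq_single l]
  · simp only [LinearMap.comp_apply]
    rw [← LinearMap.comp_apply (LinearMap.lTensor A (LinearMap.proj l)), ← LinearMap.lTensor_comp,
      LinearMap.proj_comp_single_same, LinearMap.lTensor_id, LinearMap.id_apply]
  · intro i _ hi
    simp only [LinearMap.comp_apply]
    rw [← LinearMap.comp_apply (LinearMap.lTensor A (LinearMap.proj i)), ← LinearMap.lTensor_comp,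
      LinearMap.proj_comp_single_ne _ _ _ _ hi, LinearMap.lTensor_zero]
    simp
  · simp

theorem pow_induction {n : ℕ} {p : (Fin n → B) → Prop} (h0 : p 0)
    (hadd : ∀ u v, p u → p v → p (u + v)) (hs : ∀ l b, p (Pi.single l b)) (f : Fin n → B) : p f := by
  rw [← Finset.univ_sum_single f]
  exact Finset.sum_induction _ p hadd h0 fun l _ => hs l (f l)

theorem TwistingMap.mul_right_aux (T : TwistingMap k A B) {F : Type*} [AddCommGroup F]
    [Module k F] {t : F ⊗[k] A →ₗ[k] A ⊗[k] F} (s : B →ₗ[k] F)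
    (h1 : ∀ b a, t (s b ⊗ₜ a) = s.lTensor A (T.map (b ⊗ₜ a))) (b : B) (a a' : A) :
    t (s b ⊗ₜ (a * a')) = (LinearMap.mul' k A).rTensor F ((TensorProduct.assoc k A A F).symm
      (t.lTensor A (TensorProduct.assoc k A F A (t (s b ⊗ₜ a) ⊗ₜ a')))) := by
  rw [h1, h1, T.map_mul_right]
  generalize T.map (b ⊗ₜ a) = u
  induction u using TensorProduct.induction_on with
  | zero => simp
  | add u v hu hv => simp only [TensorProduct.add_tmul, map_add, hu, hv]
  | tmul a₁ b₁ =>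
  simp only [TensorProduct.assoc_tmul, LinearMap.lTensor_tmul]
  rw [h1]
  generalize T.map (b₁ ⊗ₜ a') = u
  induction u using TensorProduct.induction_on with
  | zero => simp
  | add u v hu hv => simp only [TensorProduct.tmul_add, map_add, hu, hv]
  | tmul a₂ b₂ => simp

theorem TwistingMap.act_left_aux (T : TwistingMap k A B) {F : Type*} [AddCommGroup F]
    [Module k F] [Module Bᵐᵒᵖ F] [IsScalarTower k Bᵐᵒᵖ F] {t : F ⊗[k] A →ₗ[k] A ⊗[k] F}
    (s : B →ₗ[k] F) (h1 : ∀ b a, t (s b ⊗ₜ a) = s.lTensor A (T.map (b ⊗ₜ a)))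
    (h0 : ∀ b b', MulOpposite.op b' • s b = s (b * b')) (b b' : B) (a : A) :
    t ((MulOpposite.op b' • s b) ⊗ₜ a) =
      (rAct k B F).lTensor A (TensorProduct.assoc k A F B
        (t.rTensor B ((TensorProduct.assoc k F A B).symm (s b ⊗ₜ T.map (b' ⊗ₜ a))))) := by
  rw [h0, h1, T.map_mul_left]
  generalize T.map (b' ⊗ₜ a) = u
  induction u using TensorProduct.induction_on with
  | zero => simp
  | add u v hu hv => simp only [TensorProduct.tmul_add, map_add, hu, hv]
  | tmul a₁ b₁ =>
  simp only [TensorProduct.assoc_symm_tmul, LinearMap.rTensor_tmul]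
  rw [h1]
  generalize T.map (b ⊗ₜ a₁) = u
  induction u using TensorProduct.induction_on with
  | zero => simp
  | add u v hu hv => simp only [TensorProduct.add_tmul, map_add, hu, hv]
  | tmul a₂ b₂ => simp [h0]

/-- The module twisting map `B^n ⊗ A → A ⊗ B^n` induced by a twisting map in each component. -/
noncomputable def TwistingMap.pow (T : TwistingMap k A B) (n : ℕ) :
    ModuleTwist T (Fin n → B) where
  toEquiv := LinearEquiv.ofLinearMap (powMap n T.map) (powMapInv n T.toEquiv.symm.toLinearMap)
    (by
      refine TensorProduct.ext' fun a f => ?_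
      induction f using pow_induction with
      | h0 => simp
      | hadd u v hu hv => simp only [TensorProduct.tmul_add, map_add, hu, hv]
      | hs l b =>
      have h1 := powMapInv_single n T.toEquiv.symm.toLinearMap l (a ⊗ₜ b)
      have h2 := powMap_single n T.map l (T.toEquiv.symm (a ⊗ₜ b))
      simp only [LinearMap.lTensor_tmul, LinearMap.single_apply, LinearEquiv.coe_coe] at h1
      simp only [LinearMap.comp_apply, LinearMap.id_apply]
      rw [h1, h2]
      simp [TwistingMap.map])
    (by
      refine TensorProduct.ext' fun f a => ?_
      induction f using pow_induction with
      | h0 => simp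
      | hadd u v hu hv => simp only [TensorProduct.add_tmul, map_add, hu, hv]
      | hs l b =>
      have h1 := powMap_single n T.map l (b ⊗ₜ a)
      have h2 := powMapInv_single n T.toEquiv.symm.toLinearMap l (T.map (b ⊗ₜ a))
      simp only [LinearMap.rTensor_tmul, LinearMap.single_apply] at h1
      simp only [LinearMap.comp_apply, LinearMap.id_apply]
      rw [h1, h2]
      simp [TwistingMap.map])
  one_right f := by
    induction f using pow_induction with
    | h0 => simp
    | hadd u v hu hv => simp only [TensorProduct.tmul_add, TensorProduct.add_tmul, map_add, hu, hv]
    | hs l b =>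
    have h1 := powMap_single n T.map l (b ⊗ₜ 1)
    simp only [LinearMap.rTensor_tmul, LinearMap.single_apply, T.map_one_right,
      LinearMap.lTensor_tmul] at h1
    simpa using h1
  mul_right := by
    rw [LinearEquiv.toLinearMap_ofLinearMap]
    refine LinearMap.ext fun z => ?_
    induction z using TensorProduct.induction_on with
    | zero => rw [map_zero, map_zero]
    | add u v hu hv => rw [map_add, map_add, hu, hv]
    | tmul f z =>
    induction z using TensorProduct.induction_on with
    | zero => simp only [TensorProduct.tmul_zero, map_zero]
    | add u v hu hv => rw [TensorProduct.tmul_add, map_add, map_add, hu, hv]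
    | tmul a a' =>
    induction f using pow_induction with
    | h0 => simp only [TensorProduct.zero_tmul, map_zero]
    | hadd u v hu hv => rw [TensorProduct.add_tmul, map_add, map_add, hu, hv]
    | hs l b =>
    exact T.mul_right_aux (LinearMap.single k (fun _ : Fin n => B) l)
      (fun b a => powMap_single n T.map l (b ⊗ₜ a)) b a a'
  act_left := by
    rw [LinearEquiv.toLinearMap_ofLinearMap]
    refine LinearMap.ext fun z => ?_
    induction z using TensorProduct.induction_on with
    | zero => rw [map_zero, map_zero]
    | add u v hu hv => rw [map_add, map_add, hu, hv]
    | tmul z a =>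
    induction z using TensorProduct.induction_on with
    | zero => simp only [TensorProduct.zero_tmul, map_zero]
    | add u v hu hv => rw [TensorProduct.add_tmul, map_add, map_add, hu, hv]
    | tmul f b' =>
    induction f using pow_induction with
    | h0 => simp only [TensorProduct.zero_tmul, map_zero]
    | hadd u v hu hv =>
      rw [TensorProduct.add_tmul, TensorProduct.add_tmul, map_add, map_add, hu, hv]
    | hs l b =>
    refine T.act_left_aux (LinearMap.single k (fun _ : Fin n => B) l)
      (fun b a => powMap_single n T.map l (b ⊗ₜ a)) (fun b b' => ?_) b b' a
    simp only [LinearMap.single_apply]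
    rw [← Pi.single_smul]
    rfl

end Free

section Quantum

variable {k : Type*} [Field k]

open Polynomial in
/-- The linear map `k[y] ⊗ k[x] → k[x] ⊗ k[y]`, `yⁱ ⊗ xʲ ↦ cⁱʲ xʲ ⊗ yⁱ`. -/
noncomputable def qFlip (c : k) : k[X] ⊗[k] k[X] →ₗ[k] k[X] ⊗[k] k[X] :=
  TensorProduct.lift ((basisMonomials k).constr k fun i =>
    (basisMonomials k).constr k fun j => c ^ (i * j) • ((X ^ j : k[X]) ⊗ₜ[k] (X ^ i : k[X])))

open Polynomial in
theorem qFlip_pow (c : k) (i j : ℕ) :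
    qFlip c ((X ^ i : k[X]) ⊗ₜ (X ^ j : k[X])) = c ^ (i * j) • ((X ^ j) ⊗ₜ (X ^ i)) := by
  have h : ∀ i, (X ^ i : k[X]) = basisMonomials k i := fun i => by
    simp [X_pow_eq_monomial]
  rw [qFlip, TensorProduct.lift.tmul, h i, Module.Basis.constr_basis, h j,
    Module.Basis.constr_basis, h i, h j]

open Polynomial in
theorem poly_induction {p : k[X] → Prop} (hadd : ∀ u v, p u → p v → p (u + v))
    (hs : ∀ (c : k) u, p u → p (c • u)) (hX : ∀ i : ℕ, p (X ^ i)) (f : k[X]) : p f := by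
  induction f using Polynomial.induction_on' with
  | add u v hu hv => exact hadd u v hu hv
  | monomial i c =>
    rw [← C_mul_X_pow_eq_monomial, ← smul_eq_C_mul]
    exact hs c _ (hX i)

open Polynomial in
theorem qFlip_inv (c : k) (hc : c ≠ 0) : qFlip c⁻¹ ∘ₗ qFlip c = LinearMap.id := by
  refine TensorProduct.ext' fun f g => ?_
  induction f using poly_induction with
  | hadd u v hu hv => simp only [TensorProduct.add_tmul, map_add, hu, hv]
  | hs c u hu => simp only [← TensorProduct.smul_tmul', map_smul, hu]
  | hX i =>
  induction g using poly_induction with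
  | hadd u v hu hv => simp only [TensorProduct.tmul_add, map_add, hu, hv]
  | hs c u hu => simp only [TensorProduct.tmul_smul, map_smul, hu]
  | hX j =>
  rw [LinearMap.comp_apply, qFlip_pow, map_smul, qFlip_pow, smul_smul, mul_comm j i, ← mul_pow,
    mul_inv_cancel₀ hc, one_pow, one_smul, LinearMap.id_apply]

/-- The twisting map `R` of the quantum plane `k_q[x, y] = k[x] ⊗_R k[y]`, which extends
`R (y ⊗ x) = q x ⊗ y`. -/
noncomputable def quantumTwist (q : k) (hq : q ≠ 0) : TwistingMap k k[X] k[X] where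
  toEquiv := LinearEquiv.ofLinearMap (qFlip q) (qFlip q⁻¹)
    (by simpa using qFlip_inv q⁻¹ (inv_ne_zero hq)) (qFlip_inv q hq)
  one_right f := by
    induction f using poly_induction with
    | hadd u v hu hv => simp only [TensorProduct.tmul_add, TensorProduct.add_tmul, map_add, hu, hv]
    | hs c u hu =>
      rw [← TensorProduct.smul_tmul', map_smul, hu, TensorProduct.tmul_smul]
    | hX i => simpa using qFlip_pow q i 0
  one_left f := by
    induction f using poly_induction with
    | hadd u v hu hv => simp only [TensorProduct.tmul_add, TensorProduct.add_tmul, map_add, hu, hv]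
    | hs c u hu =>
      rw [← TensorProduct.smul_tmul', TensorProduct.tmul_smul, map_smul, hu]
    | hX i => simpa using qFlip_pow q 0 i
  mul_right := by
    refine LinearMap.ext fun z => ?_
    induction z using TensorProduct.induction_on with
    | zero => simp
    | add u v hu hv => simp only [map_add, hu, hv]
    | tmul f z =>
    induction z using TensorProduct.induction_on with
    | zero => simp
    | add u v hu hv => simp only [TensorProduct.tmul_add, map_add, hu, hv]
    | tmul g h =>
    induction f using poly_induction with
    | hadd u v hu hv => simp only [TensorProduct.add_tmul, map_add, hu, hv]
    | hs c u hu => simp only [← TensorProduct.smul_tmul', map_smul, hu]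
    | hX i =>
    induction g using poly_induction with
    | hadd u v hu hv => simp only [TensorProduct.tmul_add, TensorProduct.add_tmul, map_add, hu, hv]
    | hs c u hu => simp only [← TensorProduct.smul_tmul', TensorProduct.tmul_smul, map_smul, hu]
    | hX j =>
    induction h using poly_induction with
    | hadd u v hu hv => simp only [TensorProduct.tmul_add, map_add, hu, hv]
    | hs c u hu => simp only [TensorProduct.tmul_smul, map_smul, hu]
    | hX l =>
    simp [← pow_add, qFlip_pow, ← TensorProduct.smul_tmul', smul_smul, mul_add]
  mul_left := by
    refine TensorProduct.ext_threefold fun f g h => ?_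
    induction f using poly_induction with
    | hadd u v hu hv => simp only [TensorProduct.add_tmul, map_add, hu, hv]
    | hs c u hu => simp only [← TensorProduct.smul_tmul', map_smul, hu]
    | hX i =>
    induction g using poly_induction with
    | hadd u v hu hv => simp only [TensorProduct.tmul_add, TensorProduct.add_tmul, map_add, hu, hv]
    | hs c u hu => simp only [← TensorProduct.smul_tmul', TensorProduct.tmul_smul, map_smul, hu]
    | hX j =>
    induction h using poly_induction with
    | hadd u v hu hv => simp only [TensorProduct.tmul_add, map_add, hu, hv]
    | hs c u hu => simp only [TensorProduct.tmul_smul, map_smul, hu]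
    | hX l =>
    simp only [LinearMap.comp_apply, LinearEquiv.coe_coe, LinearMap.rTensor_tmul,
      LinearMap.lTensor_tmul, TensorProduct.assoc_tmul, TensorProduct.assoc_symm_tmul,
      LinearEquiv.toLinearMap_ofLinearMap, LinearMap.mul'_apply, ← pow_add, qFlip_pow,
      TensorProduct.tmul_smul, map_smul, ← TensorProduct.smul_tmul', smul_smul, add_mul]
    rw [add_comm (j * l)]

/-- The module twisting map `τ : F ⊗ A → A ⊗ F` of the quantum plane, for `A = k[x]` and
`F = k[y]^n`. -/
noncomputable def quantumModuleTwist (q : k) (hq : q ≠ 0) (n : ℕ) :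
    ModuleTwist (quantumTwist q hq) (Fin n → k[X]) :=
  (quantumTwist q hq).pow n

/-- The operator `λ_c (p(y)) = p(c y)`. -/
noncomputable def qShift (c : k) (p : k[X]) : k[X] := p.comp (Polynomial.C c * Polynomial.X)

end Quantum

end ProdConn

open ProdConn

/-! On a free module the theorem is linear algebra. By the Leibniz rule of the universal
differential the Grassmann map is a connection, and two connections differ by a right linear map,
because the terms `e ⊗ da` cancel. A right linear map on `A^m` is determined by its values on the
generators; each value is a finite sum of tensors `u ⊗ ω`, and each such tensor placed in column `j`
is a gauge potential with one term. This gives `exists_eq_grassmann_add_potential`.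

The Leibniz rule for the product is checked separately on `E ⊗ B` and `A ⊗ F`, against `α ⊗ β`. On
`E ⊗ B` (`nabla₁_twAct`) every term is a linear function of `R(b ⊗ α)`, since the lift of `R` to
forms commutes with `d`; on a simple tensor `a ⊗ c` the identity is the Leibniz rule for `∇^E` at
`ea` together with that for `d(cβ)`. On `A ⊗ F` (`nabla₂_twAct`) there are two independent parts.
For the part containing `∇^F`, compatibility with `τ` is exactly what carries `α` past the
connection. For the part `d ∘ σ` no condition on `∇^F` enters: invertibility of `R` gives `w` with
`R(w) = aα ⊗ β`, and the rule reduces to that for `d(aα)`.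

Grassmann connections are compatible with every componentwise twist, because the generators pass `A`
unchanged and `d` commutes with the twist. The explicit formulas follow from additivity of the
product in each connection and from `σ(x^j ⊗ y^i) = q^{-ij} y^i ⊗ x^j`. -/

namespace ProdConn

/-! ### Universal one-forms: the Leibniz rule and the right action. -/

section UniversalForms

variable {k : Type*} [Field k] {A : Type*} [Ring A] [Algebra k A]

/-- Built into the right action, which was defined by `(da) b = d(ab) - a db`. -/
theorem dU_mul (a b : A) :
    dU k A (a * b) = omegaR k A (dU k A a ⊗ₜ b) + omegaL k A (a ⊗ₜ dU k A b) := by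
  simp [dU_apply]

/-- Expanding `((a₀ da₁) a) b` gives the terms `a₀a₁a db` twice with opposite signs; what remains is
`a₀ d(a₁ab) - a₀a₁ d(ab)`. -/
theorem omegaR_mul (ω : Omega k A) (a b : A) :
    omegaR k A (ω ⊗ₜ (a * b)) = omegaR k A (omegaR k A (ω ⊗ₜ a) ⊗ₜ b) := by
  induction ω using TensorProduct.induction_on with
  | zero => simp
  | add u v hu hv => simp only [TensorProduct.add_tmul, map_add, hu, hv]
  | tmul a₀ c =>
    obtain ⟨a₁, rfl⟩ := Bar.mk_surjective k A c
    simp [TensorProduct.sub_tmul, mul_assoc]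

end UniversalForms

/-! ### Linearity of the right action on a balanced tensor product in the acting element. -/

section BalancedAction

variable {k : Type*} [Field k] {M S N : Type*} [AddCommGroup M] [Module k M]
  [AddCommMonoid S] [Module k S] [AddCommMonoid N] [Module k N]
  (ρ : M ⊗[k] S →ₗ[k] M) (l : S ⊗[k] N →ₗ[k] N) (r : N ⊗[k] S →ₗ[k] N)
  (h : r ∘ₗ l.rTensor S = l ∘ₗ r.lTensor S ∘ₗ (TensorProduct.assoc k S N S).toLinearMap)

/-- The right action on `M ⊗_S N`, linear in the acting element. -/
noncomputable def Bal.actₗ : S →ₗ[k] Bal ρ l →ₗ[k] Bal ρ l where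
  toFun s := Bal.act ρ l r h s
  map_add' s t := by
    refine LinearMap.ext fun x => ?_
    obtain ⟨z, rfl⟩ := Bal.mk_surjective ρ l x
    induction z using TensorProduct.induction_on with
    | zero => simp
    | add u v hu hv => simp only [map_add, hu, hv]
    | tmul m n =>
      simp only [Bal.act, Bal.lift_mk, LinearMap.add_apply, LinearMap.comp_apply,
        LinearMap.lTensor_tmul, map_add, TensorProduct.tmul_add]
  map_smul' c s := by
    refine LinearMap.ext fun x => ?_
    obtain ⟨z, rfl⟩ := Bal.mk_surjective ρ l x
    induction z using TensorProduct.induction_on with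
    | zero => simp
    | add u v hu hv => simp only [map_add, hu, hv]
    | tmul m n =>
      simp only [Bal.act, Bal.lift_mk, LinearMap.smul_apply, LinearMap.comp_apply,
        LinearMap.lTensor_tmul, map_smul, TensorProduct.tmul_smul, RingHom.id_apply]

theorem Bal.act_add (s t : S) (x : Bal ρ l) :
    Bal.act ρ l r h (s + t) x = Bal.act ρ l r h s x + Bal.act ρ l r h t x :=
  LinearMap.congr_fun (map_add (Bal.actₗ ρ l r h) s t) x

theorem Bal.act_zero (x : Bal ρ l) : Bal.act ρ l r h 0 x = 0 :=
  LinearMap.congr_fun (map_zero (Bal.actₗ ρ l r h)) x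

end BalancedAction

/-! ### Calculus in `E ⊗_A Ω¹A`. -/

section ModuleForms

variable {k : Type*} [Field k] {A E : Type*} [Ring A] [Algebra k A] [AddCommGroup E] [Module k E]
  [Module Aᵐᵒᵖ E] [IsScalarTower k Aᵐᵒᵖ E]

/-- The right action of `A` on `E ⊗_A Ω¹A`. -/
noncomputable abbrev formsAct (a : A) : ModForms k A E →ₗ[k] ModForms k A E :=
  Bal.act (rAct k A E) (omegaL k A) (omegaR k A) (omega_bimodule k A) a

theorem formsAct_mk (a : A) (e : E) (ω : Omega k A) :
    formsAct a (Bal.mk (rAct k A E) (omegaL k A) (e ⊗ₜ ω)) =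
      Bal.mk (rAct k A E) (omegaL k A) (e ⊗ₜ omegaR k A (ω ⊗ₜ a)) := rfl

theorem mk_op_smul_tmul (a : A) (e : E) (ω : Omega k A) :
    Bal.mk (rAct k A E) (omegaL k A) ((MulOpposite.op a • e) ⊗ₜ ω) =
      Bal.mk (rAct k A E) (omegaL k A) (e ⊗ₜ omegaL k A (a ⊗ₜ ω)) :=
  LinearMap.congr_fun (Bal.mk_balanced (rAct k A E) (omegaL k A)) ((e ⊗ₜ a) ⊗ₜ ω)

theorem modForms_induction {p : ModForms k A E → Prop} (h0 : p 0)
    (hadd : ∀ u v, p u → p v → p (u + v))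
    (hmk : ∀ e ω, p (Bal.mk (rAct k A E) (omegaL k A) (e ⊗ₜ ω))) (x : ModForms k A E) : p x := by
  obtain ⟨z, rfl⟩ := Bal.mk_surjective (rAct k A E) (omegaL k A) x
  induction z using TensorProduct.induction_on with
  | zero => rwa [map_zero]
  | add u v hu hv => rw [map_add]; exact hadd _ _ hu hv
  | tmul e ω => exact hmk e ω

theorem isUniversalConnection_iff {nabla : E →ₗ[k] ModForms k A E} :
    IsUniversalConnection nabla ↔ ∀ (e : E) (a : A), nabla (MulOpposite.op a • e) =
      formsAct a (nabla e) + Bal.mk (rAct k A E) (omegaL k A) (e ⊗ₜ dU k A a) := Iff.rfl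

end ModuleForms

/-! ### Connections on free modules: Grassmann connection plus gauge potential. -/

section FreeModules

variable {k : Type*} [Field k] {A : Type*} [Ring A] [Algebra k A] {m : ℕ}

theorem grassmann_apply (e : Fin m → A) : grassmann k A m e =
    ∑ i, Bal.mk (rAct k A (Fin m → A)) (omegaL k A) (Pi.single i 1 ⊗ₜ dU k A (e i)) := by
  simp [grassmann]

theorem potential_apply {s : ℕ} (φ : Fin s → Module.End Aᵐᵒᵖ (Fin m → A))
    (ω : Fin s → Omega k A) (e : Fin m → A) : potential φ ω e =
    ∑ i, ∑ j, Bal.mk (rAct k A (Fin m → A)) (omegaL k A)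
      (φ i (Pi.single j 1) ⊗ₜ omegaR k A (ω i ⊗ₜ e j)) := by
  simp [potential]

theorem sum_op_smul_single (e : Fin m → A) :
    ∑ i, MulOpposite.op (e i) • (Pi.single i 1 : Fin m → A) = e := by
  conv_rhs => rw [← Finset.univ_sum_single e]
  refine Finset.sum_congr rfl fun i _ => ?_
  rw [← Pi.single_smul, op_smul_eq_mul, one_mul]

theorem grassmann_isUniversalConnection (m : ℕ) :
    IsUniversalConnection (grassmann k A m) := by
  rw [isUniversalConnection_iff]
  intro e a
  -- Only the `e` in `e ⊗ da` is expanded in generators. Balancing then turns this term into `∑ eᵢ ⊗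
  -- aᵢ da`, the second half of `∑ eᵢ ⊗ d(aᵢ a)`.
  conv_rhs => enter [2, 2]; rw [← sum_op_smul_single e]
  simp only [grassmann_apply, map_sum, TensorProduct.sum_tmul, formsAct_mk, mk_op_smul_tmul,
    Pi.smul_apply, op_smul_eq_mul, dU_mul, TensorProduct.tmul_add, map_add,
    Finset.sum_add_distrib]

/-- Coordinates enter a potential only through `ωᵢ aⱼ`, so associativity of the right action on
forms moves the scalar outside. -/
theorem potential_op_smul {s : ℕ} (φ : Fin s → Module.End Aᵐᵒᵖ (Fin m → A))
    (ω : Fin s → Omega k A) (e : Fin m → A) (a : A) :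
    potential φ ω (MulOpposite.op a • e) = formsAct a (potential φ ω e) := by
  simp only [potential_apply, map_sum, formsAct_mk, Pi.smul_apply, op_smul_eq_mul,
    omegaR_mul]

theorem grassmann_add_potential_isUniversalConnection {s : ℕ}
    (φ : Fin s → Module.End Aᵐᵒᵖ (Fin m → A)) (ω : Fin s → Omega k A) :
    IsUniversalConnection (grassmann k A m + potential φ ω) := by
  rw [isUniversalConnection_iff]
  intro e a
  rw [LinearMap.add_apply, LinearMap.add_apply, map_add, potential_op_smul,
    isUniversalConnection_iff.1 (grassmann_isUniversalConnection m)]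
  abel

/-- Gauge potentials, as a property of linear maps `A^m → A^m ⊗_A Ω¹A`. -/
def IsPotential (D : (Fin m → A) →ₗ[k] ModForms k A (Fin m → A)) : Prop :=
  ∃ (s : ℕ) (φ : Fin s → Module.End Aᵐᵒᵖ (Fin m → A)) (ω : Fin s → Omega k A),
    D = potential φ ω

theorem IsPotential.zero :
    IsPotential (0 : (Fin m → A) →ₗ[k] ModForms k A (Fin m → A)) :=
  ⟨0, Fin.elim0, Fin.elim0, by simp [potential]⟩

/-- Concatenating the two families adds the potentials. Closure under sums reduces later arguments
to simple tensors. -/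
theorem IsPotential.add {D D' : (Fin m → A) →ₗ[k] ModForms k A (Fin m → A)}
    (h : IsPotential D) (h' : IsPotential D') : IsPotential (D + D') := by
  obtain ⟨s, φ, ω, rfl⟩ := h
  obtain ⟨t, ψ, η, rfl⟩ := h'
  exact ⟨s + t, Fin.append φ ψ, Fin.append ω η, by simp [potential, Fin.sum_univ_add]⟩

/-- The linear map `(a₁, …, aₘ) ↦ x aⱼ`, for `x` in `A^m ⊗_A Ω¹A`. -/
noncomputable def coordAct (j : Fin m) (x : ModForms k A (Fin m → A)) :
    (Fin m → A) →ₗ[k] ModForms k A (Fin m → A) :=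
  (Bal.actₗ (rAct k A (Fin m → A)) (omegaL k A) (omegaR k A) (omega_bimodule k A)).flip x ∘ₗ
    LinearMap.proj j

theorem coordAct_apply (j : Fin m) (x : ModForms k A (Fin m → A)) (e : Fin m → A) :
    coordAct j x e = formsAct (e j) x := rfl

/-- The building block of the classification: a matrix of one-forms whose only nonzero column is the
`j`-th. -/
theorem isPotential_coordAct (j : Fin m) (x : ModForms k A (Fin m → A)) :
    IsPotential (coordAct j x) := by
  induction x using modForms_induction with
  | h0 =>
    convert IsPotential.zero (k := k) (A := A) (m := m)
    refine LinearMap.ext fun e => ?_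
    simp [coordAct_apply]
  | hadd u v hu hv =>
    convert hu.add hv
    refine LinearMap.ext fun e => ?_
    simp [coordAct_apply]
  | hmk u ω =>
    -- The witness for `x = u ⊗ ω`. It is right linear because `u` multiplies from the left; it
    -- sends the `j`-th generator to `u` and kills the others.
    let φ : Module.End Aᵐᵒᵖ (Fin m → A) :=
      { toFun := fun e => fun i => u i * e j
        map_add' := fun e e' => by ext i; simp [mul_add]
        map_smul' := fun c e => by ext i; simp [MulOpposite.smul_eq_mul_unop, mul_assoc] }
    refine ⟨1, fun _ => φ, fun _ => ω, LinearMap.ext fun e => ?_⟩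
    have hj : φ (Pi.single j 1) = u := by ext i; simp [φ]
    have hne : ∀ l, l ≠ j → φ (Pi.single l 1) = 0 := fun l hl => by
      ext i; simp [φ, Pi.single_eq_of_ne hl.symm]
    rw [potential_apply, Fin.sum_univ_one, Finset.sum_eq_single j
      (fun l _ hl => by rw [hne l hl, TensorProduct.zero_tmul, map_zero]) (by simp), hj]
    rfl

/-- Right linearity gives `D(e) = ∑ⱼ D(eⱼ) aⱼ`, a sum of one-column potentials. -/
theorem isPotential_of_op_smul (D : (Fin m → A) →ₗ[k] ModForms k A (Fin m → A))
    (hD : ∀ e a, D (MulOpposite.op a • e) = formsAct a (D e)) : IsPotential D := by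
  have h : D = ∑ j, coordAct j (D (Pi.single j 1)) := LinearMap.ext fun e => by
    conv_lhs => rw [← sum_op_smul_single e]
    simp only [map_sum, hD, LinearMap.sum_apply, coordAct_apply]
  rw [h]
  exact Finset.sum_induction _ IsPotential (fun _ _ => IsPotential.add) IsPotential.zero
    fun j _ => isPotential_coordAct j _

/-- Connections form an affine space: the derivation terms cancel in `∇ - ∇₀`, leaving a right
linear map. -/
theorem exists_eq_grassmann_add_potential {nabla : (Fin m → A) →ₗ[k] ModForms k A (Fin m → A)}
    (h : IsUniversalConnection nabla) :
    ∃ (s : ℕ) (φ : Fin s → Module.End Aᵐᵒᵖ (Fin m → A)) (ω : Fin s → Omega k A),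
      nabla = grassmann k A m + potential φ ω := by
  obtain ⟨s, φ, ω, hD⟩ := isPotential_of_op_smul (nabla - grassmann k A m) fun e a => by
    rw [LinearMap.sub_apply, LinearMap.sub_apply, map_sub, isUniversalConnection_iff.1 h,
      isUniversalConnection_iff.1 (grassmann_isUniversalConnection m)]
    abel
  exact ⟨s, φ, ω, by rw [← hD]; abel⟩

end FreeModules

/-! ### The lifted twist, and the actions on the one-forms of `A ⊗_R B`. -/

section TwistedForms

variable {k : Type*} [Field k] {A B : Type*} [Ring A] [Algebra k A] [Ring B] [Algebra k B]
  (T : TwistingMap k A B)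

namespace TwistingMap

/-- This is the defining property of the lift. It holds because `da` has coefficient `1`, and `R(b ⊗
1) = 1 ⊗ b` lets `b` pass that coefficient unchanged. -/
theorem omegaA_dU (b : B) (a : A) :
    T.omegaA (b ⊗ₜ dU k A a) = (dU k A).rTensor B (T.map (b ⊗ₜ a)) := by
  simp only [omegaA, dU_apply, LinearMap.comp_apply, LinearEquiv.coe_coe,
    TensorProduct.assoc_symm_tmul, LinearMap.rTensor_tmul, map_one_right,
    TensorProduct.assoc_tmul, LinearMap.lTensor_tmul, barA_tmul]
  generalize T.map (b ⊗ₜ a) = u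
  induction u using TensorProduct.induction_on with
  | zero => simp
  | add u v hu hv => simp only [TensorProduct.tmul_add, map_add, hu, hv]
  | tmul a b => simp [dU_apply]

theorem omegaB_dU (b : B) (a : A) :
    T.omegaB (dU k B b ⊗ₜ a) = (dU k B).lTensor A (T.map (b ⊗ₜ a)) := by
  simp only [omegaB, dU_apply, LinearMap.comp_apply, LinearEquiv.coe_coe,
    TensorProduct.assoc_tmul, LinearMap.lTensor_tmul, barB_tmul]
  generalize T.map (b ⊗ₜ a) = u
  induction u using TensorProduct.induction_on with
  | zero => simp
  | add u v hu hv => simp only [TensorProduct.tmul_add, map_add, hu, hv]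
  | tmul a b => simp [dU_apply, map_one_left]

theorem omegaA_one (ω : Omega k A) : T.omegaA (1 ⊗ₜ ω) = ω ⊗ₜ 1 := by
  induction ω using TensorProduct.induction_on with
  | zero => simp
  | add u v hu hv => simp only [TensorProduct.tmul_add, TensorProduct.add_tmul, map_add, hu, hv]
  | tmul a₀ c =>
    obtain ⟨a₁, rfl⟩ := Bar.mk_surjective k A c
    simp [omegaA, T.map_one_left]

theorem omegaL_one {C : Type*} [Ring C] [Algebra k C] (ω : Omega k C) :
    omegaL k C (1 ⊗ₜ ω) = ω := by
  induction ω using TensorProduct.induction_on with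
  | zero => simp
  | add u v hu hv => simp only [TensorProduct.tmul_add, map_add, hu, hv]
  | tmul a c => simp

/-- The left-action formulas treat the factors `a ⊗ 1` and `1 ⊗ b` separately. For `a ⊗ 1` the twist
disappears; for `1 ⊗ b` the twist stays but the multiplication on the `A` side is by `1`. -/
theorem formsL_left_fst (a : A) (ω : Omega k A) (b : B) :
    T.formsL ((a ⊗ₜ 1) ⊗ₜ (ω ⊗ₜ b, 0)) = (omegaL k A (a ⊗ₜ ω) ⊗ₜ b, 0) := by
  simp [formsL, twAct_tmul, omegaA_one]

theorem formsL_left_snd (a a' : A) (η : Omega k B) :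
    T.formsL ((a ⊗ₜ 1) ⊗ₜ (0, a' ⊗ₜ η)) = (0, (a * a') ⊗ₜ η) := by
  simp [formsL, twAct_tmul, map_one_left, omegaL_one]

theorem formsL_right_fst (b : B) (ω : Omega k A) (b' : B) :
    T.formsL ((1 ⊗ₜ b) ⊗ₜ (ω ⊗ₜ b', 0)) =
      ((LinearMap.mul' k B ∘ₗ (TensorProduct.mk k B B).flip b').lTensor _
        (T.omegaA (b ⊗ₜ ω)), 0) := by
  have h : omegaL k A ∘ₗ TensorProduct.mk k A _ 1 = LinearMap.id :=
    LinearMap.ext fun ω => omegaL_one ω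
  simp [formsL, twAct_tmul, h, LinearMap.lTensor]

theorem formsL_right_snd (b : B) (a : A) (η : Omega k B) :
    T.formsL ((1 ⊗ₜ b) ⊗ₜ (0, a ⊗ₜ η)) =
      (0, (omegaL k B ∘ₗ (TensorProduct.mk k B _).flip η).lTensor A (T.map (b ⊗ₜ a))) := by
  have h : LinearMap.mul' k A ∘ₗ TensorProduct.mk k A A 1 = LinearMap.id :=
    LinearMap.ext fun ω => one_mul ω
  simp [formsL, twAct_tmul, h, LinearMap.lTensor]

theorem formsR_left_fst (ω : Omega k A) (b : B) (a : A) (b' : B) :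
    T.formsR ((ω ⊗ₜ b, 0) ⊗ₜ (a ⊗ₜ b')) =
      (TensorProduct.map (omegaR k A ∘ₗ TensorProduct.mk k _ A ω)
        (LinearMap.mul' k B ∘ₗ (TensorProduct.mk k B B).flip b') (T.map (b ⊗ₜ a)), 0) := by
  simp [formsR, twAct_tmul]

theorem formsR_snd (η : Omega k B) (a : A) (b : B) :
    T.formsR ((0, 1 ⊗ₜ η) ⊗ₜ (a ⊗ₜ b)) =
      (0, (omegaR k B ∘ₗ (TensorProduct.mk k _ B).flip b).lTensor A (T.omegaB (η ⊗ₜ a))) := by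
  have h : LinearMap.mul' k A ∘ₗ TensorProduct.mk k A A 1 = LinearMap.id :=
    LinearMap.ext fun ω => one_mul ω
  simp [formsR, twAct_tmul, h, LinearMap.lTensor]

end TwistingMap
end TwistedForms

/-! ### Module twisting maps and the two halves of a product connection. -/

namespace ModuleTwist

variable {k : Type*} [Field k] {A B : Type*} [Ring A] [Algebra k A] [Ring B] [Algebra k B]
  {T : TwistingMap k A B} {F : Type*} [AddCommGroup F] [Module k F]
  [Module Bᵐᵒᵖ F] [IsScalarTower k Bᵐᵒᵖ F] (τ : ModuleTwist T F)
  {E : Type*} [AddCommGroup E] [Module k E] [Module Aᵐᵒᵖ E] [IsScalarTower k Aᵐᵒᵖ E]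

theorem map_one_right (f : F) : τ.map (f ⊗ₜ 1) = 1 ⊗ₜ f := τ.one_right f

theorem map_mul_right (f : F) (a a' : A) : τ.map (f ⊗ₜ (a * a')) =
    (LinearMap.mul' k A).rTensor F ((TensorProduct.assoc k A A F).symm
      (τ.map.lTensor A (TensorProduct.assoc k A F A (τ.map (f ⊗ₜ a) ⊗ₜ a')))) :=
  LinearMap.congr_fun τ.mul_right (f ⊗ₜ (a ⊗ₜ a'))

theorem inv_map (z : F ⊗[k] A) : τ.inv (τ.map z) = z := τ.toEquiv.symm_apply_apply z

theorem map_surjective : Function.Surjective τ.map := τ.toEquiv.surjective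

theorem pass_mk (f : F) (η : Omega k B) (a : A) :
    τ.pass (Bal.mk (rAct k B F) (omegaL k B) (f ⊗ₜ η) ⊗ₜ a) = τ.passAux ((f ⊗ₜ η) ⊗ₜ a) := rfl

theorem inclE_mk (e : E) (ω : Omega k A) (b : B) :
    τ.inclE E (Bal.mk (rAct k A E) (omegaL k A) (e ⊗ₜ ω) ⊗ₜ b) =
      τ.cls E (e ⊗ₜ 1, 0) (ω ⊗ₜ b, 0) := rfl

theorem inclF_mk (f : F) (η : Omega k B) (a : A) :
    τ.inclF E (a ⊗ₜ Bal.mk (rAct k B F) (omegaL k B) (f ⊗ₜ η)) =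
      τ.cls E (0, a ⊗ₜ f) (0, 1 ⊗ₜ η) := rfl

variable (E) in
/-- The class `m ⊗_{A ⊗_R B} ν`, as a bilinear map. -/
noncomputable def clsₗ : ((E ⊗[k] B) × (A ⊗[k] F)) →ₗ[k]
    ((Omega k A ⊗[k] B) × (A ⊗[k] Omega k B)) →ₗ[k] τ.Target E :=
  TensorProduct.curry (τ.toTarget E) ∘ₗ (τ.pair E).toLinearMap

theorem nabla₁_tmul (nablaE : E →ₗ[k] ModForms k A E) (e : E) (b : B) :
    τ.nabla₁ nablaE (e ⊗ₜ b) = τ.inclE E (nablaE e ⊗ₜ b) +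
      τ.cls E (e ⊗ₜ 1, 0) (0, 1 ⊗ₜ dU k B b) := rfl

theorem product_pair (nablaE : E →ₗ[k] ModForms k A E) (nablaF : F →ₗ[k] ModForms k B F)
    (x : E ⊗[k] B) (y : A ⊗[k] F) :
    τ.product nablaE nablaF (τ.pair E (x, y)) = τ.nabla₁ nablaE x + τ.nabla₂ nablaF y := rfl

/-- The summand with `dU` does not involve the connection, so a perturbation enters only through
`inclE`. -/
theorem nabla₁_add (nablaE D : E →ₗ[k] ModForms k A E) (x : E ⊗[k] B) :
    τ.nabla₁ (nablaE + D) x = τ.nabla₁ nablaE x + τ.inclE E (D.rTensor B x) := by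
  simp only [nabla₁, LinearMap.rTensor_add, LinearMap.comp_add, LinearMap.add_apply,
    LinearMap.comp_apply]
  abel

theorem nabla₂_add (nablaF D : F →ₗ[k] ModForms k B F) (y : A ⊗[k] F) :
    τ.nabla₂ (E := E) (nablaF + D) y = τ.nabla₂ nablaF y + τ.inclF E (D.lTensor A y) := by
  simp only [nabla₂, LinearMap.lTensor_add, LinearMap.comp_add, LinearMap.add_apply,
    LinearMap.comp_apply]
  abel

end ModuleTwist

/-! ### Balancing over `A ⊗_R B` and the Leibniz rule of the product. -/

namespace ModuleTwist

variable {k : Type*} [Field k] {A B : Type*} [Ring A] [Algebra k A] [Ring B] [Algebra k B]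
  {T : TwistingMap k A B} {F : Type*} [AddCommGroup F] [Module k F]
  [Module Bᵐᵒᵖ F] [IsScalarTower k Bᵐᵒᵖ F] (τ : ModuleTwist T F)
  {E : Type*} [AddCommGroup E] [Module k E] [Module Aᵐᵒᵖ E] [IsScalarTower k Aᵐᵒᵖ E]

variable (E) in
/-- The right action of `A ⊗_R B` on the target of a product connection. -/
noncomputable abbrev targetAct (s : A ⊗[k] B) : τ.Target E →ₗ[k] τ.Target E :=
  Bal.act (M := τ.ProdMod E) (S := A ⊗[k] B) (N := T.Forms) (τ.prodR E) T.formsL T.formsR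
    T.forms_bimodule s

theorem targetAct_cls (s : A ⊗[k] B) (m : (E ⊗[k] B) × (A ⊗[k] F)) (ν : T.Forms) :
    τ.targetAct E s (τ.cls E m ν) = τ.cls E m (T.formsR (ν ⊗ₜ s)) := rfl

theorem cls_add_left (m m' : (E ⊗[k] B) × (A ⊗[k] F)) (ν : T.Forms) :
    τ.cls E (m + m') ν = τ.cls E m ν + τ.cls E m' ν :=
  LinearMap.congr_fun (map_add (τ.clsₗ E) m m') ν

theorem cls_add_right (m : (E ⊗[k] B) × (A ⊗[k] F)) (ν ν' : T.Forms) :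
    τ.cls E m (ν + ν') = τ.cls E m ν + τ.cls E m ν' :=
  map_add (τ.clsₗ E m) ν ν'

theorem cls_zero_left (ν : T.Forms) : τ.cls E 0 ν = 0 :=
  LinearMap.congr_fun (map_zero (τ.clsₗ E)) ν

theorem cls_zero_right (m : (E ⊗[k] B) × (A ⊗[k] F)) : τ.cls E m 0 = 0 :=
  map_zero (τ.clsₗ E m)

theorem cls_right_fst_add (m : (E ⊗[k] B) × (A ⊗[k] F)) (u v : Omega k A ⊗[k] B) :
    τ.cls E m (u + v, 0) = τ.cls E m (u, 0) + τ.cls E m (v, 0) := by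
  rw [← cls_add_right, Prod.mk_add_mk, add_zero]

theorem cls_right_snd_add (m : (E ⊗[k] B) × (A ⊗[k] F)) (u v : A ⊗[k] Omega k B) :
    τ.cls E m (0, u + v) = τ.cls E m (0, u) + τ.cls E m (0, v) := by
  rw [← cls_add_right, Prod.mk_add_mk, add_zero]

theorem cls_left_snd_add (u v : A ⊗[k] F) (ν : T.Forms) :
    τ.cls E (0, u + v) ν = τ.cls E (0, u) ν + τ.cls E (0, v) ν := by
  rw [← cls_add_left, Prod.mk_add_mk, add_zero]

theorem cls_left_fst_add (u v : E ⊗[k] B) (ν : T.Forms) :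
    τ.cls E (u + v, 0) ν = τ.cls E (u, 0) ν + τ.cls E (v, 0) ν := by
  rw [← cls_add_left, Prod.mk_add_mk, add_zero]

theorem cls_right_split (m : (E ⊗[k] B) × (A ⊗[k] F)) (u : Omega k A ⊗[k] B)
    (v : A ⊗[k] Omega k B) : τ.cls E m (u, v) = τ.cls E m (u, 0) + τ.cls E m (0, v) := by
  rw [← cls_add_right, Prod.mk_add_mk, add_zero, zero_add]

theorem prodR_tmul (x : E ⊗[k] B) (y : A ⊗[k] F) (s : A ⊗[k] B) :
    τ.prodR E (τ.pair E (x, y) ⊗ₜ s) = τ.pair E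
      (twAct (rAct k A E) (LinearMap.mul' k B) T.map (x ⊗ₜ s),
        twAct (LinearMap.mul' k A) (rAct k B F) τ.map (y ⊗ₜ s)) := rfl

/-- The balancing relation in coordinates. The next four lemmas specialise it by writing a module
element as a product, for instance `e ⊗ b = (e ⊗ 1)(1 ⊗ b)`. -/
theorem cls_twAct (x : E ⊗[k] B) (y : A ⊗[k] F) (s : A ⊗[k] B) (ν : T.Forms) :
    τ.cls E (twAct (rAct k A E) (LinearMap.mul' k B) T.map (x ⊗ₜ s),
        twAct (LinearMap.mul' k A) (rAct k B F) τ.map (y ⊗ₜ s)) ν =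
      τ.cls E (x, y) (T.formsL (s ⊗ₜ ν)) :=
  τ.cls_balanced (x, y) s ν

theorem cls_op_smul_left (e : E) (a : A) (η : Omega k B) :
    τ.cls E ((MulOpposite.op a • e) ⊗ₜ 1, 0) (0, 1 ⊗ₜ η) =
      τ.cls E (e ⊗ₜ 1, 0) (0, a ⊗ₜ η) := by
  have h := τ.cls_twAct (e ⊗ₜ 1) 0 (a ⊗ₜ 1) (0, 1 ⊗ₜ η)
  simpa [twAct_tmul, T.map_one_left, T.formsL_left_snd] using h

theorem cls_fst_tmul (e : E) (b : B) (ν : T.Forms) :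
    τ.cls E (e ⊗ₜ b, 0) ν = τ.cls E (e ⊗ₜ 1, 0) (T.formsL ((1 ⊗ₜ b) ⊗ₜ ν)) := by
  have h := τ.cls_twAct (e ⊗ₜ 1) 0 (1 ⊗ₜ b) ν
  simpa [twAct_tmul, T.map_one_left] using h

theorem cls_snd_op_smul (f : F) (b : B) (ν : T.Forms) :
    τ.cls E (0, 1 ⊗ₜ (MulOpposite.op b • f)) ν =
      τ.cls E (0, 1 ⊗ₜ f) (T.formsL ((1 ⊗ₜ b) ⊗ₜ ν)) := by
  have h := τ.cls_twAct (E := E) 0 (1 ⊗ₜ f) (1 ⊗ₜ b) ν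
  simpa [twAct_tmul, τ.map_one_right] using h

theorem cls_snd_map (a : A) (f : F) (a' : A) (ν : T.Forms) :
    τ.cls E (0, (LinearMap.mulLeft k a).rTensor F (τ.map (f ⊗ₜ a'))) ν =
      τ.cls E (0, a ⊗ₜ f) (T.formsL ((a' ⊗ₜ 1) ⊗ₜ ν)) := by
  have h := τ.cls_twAct (E := E) 0 (a ⊗ₜ f) (a' ⊗ₜ 1) ν
  have h1 : LinearMap.mul' k A ∘ₗ TensorProduct.mk k A A a = LinearMap.mulLeft k a := rfl
  have h2 : rAct k B F ∘ₗ (TensorProduct.mk k F B).flip 1 = LinearMap.id :=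
    LinearMap.ext fun f => by simp
  simpa [twAct_tmul, h1, h2, LinearMap.rTensor] using h

/-- The action touches only the form `ω ⊗ b`: `R` moves `α` past `b`, after which the two factors
are multiplied separately. -/
theorem targetAct_inclE (x : ModForms k A E) (b : B) (α : A) (β : B) :
    τ.targetAct E (α ⊗ₜ β) (τ.inclE E (x ⊗ₜ b)) = τ.inclE E (TensorProduct.map
      ((Bal.actₗ (rAct k A E) (omegaL k A) (omegaR k A) (omega_bimodule k A)).flip x)
      (LinearMap.mulRight k β) (T.map (b ⊗ₜ α))) := by
  induction x using modForms_induction with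
  | h0 => simp
  | hadd u v hu hv =>
    simp only [TensorProduct.add_tmul, map_add, hu, hv, TensorProduct.map_add_left,
      LinearMap.add_apply]
  | hmk e ω =>
    rw [inclE_mk, targetAct_cls, T.formsR_left_fst]
    generalize T.map (b ⊗ₜ α) = u
    induction u using TensorProduct.induction_on with
    | zero => simp [← Prod.zero_eq_mk, cls_zero_right]
    | add u v hu hv => simp only [map_add, cls_right_fst_add, hu, hv]
    | tmul a b => rfl

/-- Leibniz rule on `E ⊗ B`. If `a ⊗ c` is a term of `R(b ⊗ α)`, then `∇(ea)` yields `(∇e)a` and `e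
⊗ da`, while `d(cβ)` yields `(dc)β` and `c dβ`. The first term of each pair belongs to the action on
`∇(e ⊗ b)`, the second to the tensor with `d(α ⊗ β)`. -/
theorem nabla₁_twAct {nablaE : E →ₗ[k] ModForms k A E} (hE : IsUniversalConnection nablaE)
    (e : E) (b : B) (α : A) (β : B) :
    τ.nabla₁ nablaE (twAct (rAct k A E) (LinearMap.mul' k B) T.map
      ((e ⊗ₜ b) ⊗ₜ (α ⊗ₜ β))) = τ.targetAct E (α ⊗ₜ β) (τ.nabla₁ nablaE (e ⊗ₜ b)) +
        τ.cls E (e ⊗ₜ b, 0) (dU k A α ⊗ₜ β, α ⊗ₜ dU k B β) := by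
  rw [nabla₁_tmul, map_add, targetAct_inclE, targetAct_cls, T.formsR_snd,
    τ.cls_right_split (e ⊗ₜ b, 0), τ.cls_fst_tmul e b, τ.cls_fst_tmul e b, T.formsL_right_fst,
    T.formsL_right_snd, T.omegaA_dU, T.omegaB_dU, twAct_tmul]
  -- After commuting `d` with the twist, both sides depend linearly on this single element, so
  -- simple tensors suffice.
  generalize T.map (b ⊗ₜ α) = u
  induction u using TensorProduct.induction_on with
  | zero => simp [← Prod.zero_eq_mk, cls_zero_right]
  | add u v hu hv =>
    simp only [map_add, cls_right_fst_add, cls_right_snd_add, hu, hv]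
    abel
  | tmul a c =>
    simp only [TensorProduct.map_tmul, LinearMap.comp_apply, TensorProduct.mk_apply,
      LinearMap.flip_apply, rAct_tmul, LinearMap.mul'_apply, nabla₁_tmul,
      isUniversalConnection_iff.1 hE e a, TensorProduct.add_tmul, map_add, inclE_mk, dU_mul,
      TensorProduct.tmul_add, cls_right_snd_add, cls_op_smul_left, LinearMap.lTensor_tmul,
      LinearMap.rTensor_tmul, LinearMap.mulRight_apply]
    have h : Bal.actₗ (rAct k A E) (omegaL k A) (omegaR k A) (omega_bimodule k A) a (nablaE e) =
      formsAct a (nablaE e) := rfl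
    rw [h]
    abel

/-- The lifted `R` takes `α` past the form and balancing then takes it past `f` by `τ`; the
composite of the two moves is `pass`. -/
theorem targetAct_inclF (x : ModForms k B F) (a α : A) (β : B) :
    τ.targetAct E (α ⊗ₜ β) (τ.inclF E (a ⊗ₜ x)) = τ.inclF E (TensorProduct.map
      (LinearMap.mulLeft k a) (formsAct β) (τ.pass (x ⊗ₜ α))) := by
  induction x using modForms_induction with
  | h0 => simp
  | hadd u v hu hv => simp only [TensorProduct.add_tmul, TensorProduct.tmul_add, map_add, hu, hv]
  | hmk f η =>
    rw [inclF_mk, targetAct_cls, T.formsR_snd, pass_mk]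
    simp only [passAux, LinearMap.comp_apply, LinearEquiv.coe_coe, TensorProduct.assoc_tmul,
      LinearMap.lTensor_tmul]
    generalize T.omegaB (η ⊗ₜ α) = u
    induction u using TensorProduct.induction_on with
    | zero => simp [← Prod.zero_eq_mk, cls_zero_right]
    | add u v hu hv => simp only [TensorProduct.tmul_add, map_add, cls_right_snd_add, hu, hv]
    | tmul a₁ η₁ =>
    -- Balancing carries `a₁` from the form back to the module element, where it becomes `a τ(f ⊗
    -- a₁)`.
    have h := τ.cls_snd_map (E := E) a f a₁ (0, 1 ⊗ₜ omegaR k B (η₁ ⊗ₜ β))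
    rw [T.formsL_left_snd, mul_one] at h
    simp only [LinearMap.lTensor_tmul, LinearMap.comp_apply, LinearMap.flip_apply,
      TensorProduct.mk_apply, TensorProduct.assoc_symm_tmul, LinearMap.rTensor_tmul]
    rw [← h]
    generalize τ.map (f ⊗ₜ a₁) = v
    induction v using TensorProduct.induction_on with
    | zero => simp [← Prod.zero_eq_mk, cls_zero_left]
    | add u v hu hv => simp only [TensorProduct.add_tmul, map_add, cls_left_snd_add, hu, hv]
    | tmul a₂ f₂ => rfl

/-- The part of the Leibniz rule on `A ⊗ F` that contains `∇^F`. Compatibility replaces `pass` of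
`∇f ⊗ α` by `∇^F` applied after `τ`, and the Leibniz rule of `∇^F` for right multiplication by `β`
does the rest. -/
theorem inclF_lTensor_twAct {nablaF : F →ₗ[k] ModForms k B F}
    (hF : IsUniversalConnection nablaF) (hτ : τ.Compatible nablaF) (a : A) (f : F)
    (α : A) (β : B) :
    τ.inclF E (nablaF.lTensor A (twAct (LinearMap.mul' k A) (rAct k B F) τ.map
      ((a ⊗ₜ f) ⊗ₜ (α ⊗ₜ β)))) = τ.targetAct E (α ⊗ₜ β) (τ.inclF E (a ⊗ₜ nablaF f)) +
        τ.cls E (0, a ⊗ₜ f) (0, α ⊗ₜ dU k B β) := by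
  have h1 : nablaF.lTensor A (τ.map (f ⊗ₜ α)) = τ.pass (nablaF f ⊗ₜ α) :=
    LinearMap.congr_fun hτ (f ⊗ₜ α)
  have h2 := τ.cls_snd_map (E := E) a f α (0, 1 ⊗ₜ dU k B β)
  rw [T.formsL_left_snd, mul_one] at h2
  rw [targetAct_inclF, ← h1, ← h2, twAct_tmul]
  generalize τ.map (f ⊗ₜ α) = u
  induction u using TensorProduct.induction_on with
  | zero => simp [← Prod.zero_eq_mk, cls_zero_left]
  | add u v hu hv =>
    simp only [map_add, cls_left_snd_add, hu, hv]
    abel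
  | tmul a' f' =>
    simp only [TensorProduct.map_tmul, LinearMap.comp_apply, TensorProduct.mk_apply,
      LinearMap.flip_apply, rAct_tmul, LinearMap.mul'_apply, LinearMap.lTensor_tmul,
      LinearMap.rTensor_tmul, isUniversalConnection_iff.1 hF f' β, TensorProduct.tmul_add,
      map_add, inclF_mk, LinearMap.mulLeft_apply]

variable (E) in
/-- The map `F ⊗ A → Target`, `f ⊗ a ↦ (1 ⊗ f) ⊗ (d a ⊗ 1)`. -/
noncomputable def dLeft : F ⊗[k] A →ₗ[k] τ.Target E :=
  τ.toTarget E ∘ₗ TensorProduct.map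
      ((τ.pair E).toLinearMap ∘ₗ LinearMap.inr k (E ⊗[k] B) (A ⊗[k] F) ∘ₗ TensorProduct.mk k A F 1)
      (LinearMap.inl k (Omega k A ⊗[k] B) (A ⊗[k] Omega k B) ∘ₗ
        (TensorProduct.mk k (Omega k A) B).flip 1 ∘ₗ dU k A)

theorem dLeft_tmul (f : F) (a : A) :
    τ.dLeft E (f ⊗ₜ a) = τ.cls E (0, 1 ⊗ₜ f) (dU k A a ⊗ₜ 1, 0) := rfl

theorem nabla₂_apply (nablaF : F →ₗ[k] ModForms k B F) (y : A ⊗[k] F) :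
    τ.nabla₂ (E := E) nablaF y = τ.inclF E (nablaF.lTensor A y) + τ.dLeft E (τ.inv y) := rfl

/-- Multiplicativity of `τ` in `A`: passing `a` and then `α` is the same as passing `aα`. -/
theorem twAct_map_tmul (f : F) (a α : A) (β : B) :
    twAct (LinearMap.mul' k A) (rAct k B F) τ.map (τ.map (f ⊗ₜ a) ⊗ₜ (α ⊗ₜ β)) =
      (rAct k B F ∘ₗ (TensorProduct.mk k F B).flip β).lTensor A (τ.map (f ⊗ₜ (a * α))) := by
  rw [map_mul_right]
  generalize τ.map (f ⊗ₜ a) = u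
  induction u using TensorProduct.induction_on with
  | zero => simp
  | add u v hu hv => simp only [TensorProduct.add_tmul, map_add, hu, hv]
  | tmul a f =>
    simp only [twAct_tmul, TensorProduct.assoc_tmul, LinearMap.lTensor_tmul]
    generalize τ.map (f ⊗ₜ α) = u
    induction u using TensorProduct.induction_on with
    | zero => simp
    | add u v hu hv => simp only [TensorProduct.tmul_add, map_add, hu, hv]
    | tmul a f => simp

/-- The linear extension of `map_act`, needed because a preimage under `R` need not be a simple
tensor. -/
theorem map_rTensor_act (f : F) (w : B ⊗[k] A) :
    τ.map ((rAct k B F ∘ₗ TensorProduct.mk k F B f).rTensor A w) =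
      (rAct k B F).lTensor A (TensorProduct.assoc k A F B
        (τ.map.rTensor B ((TensorProduct.assoc k F A B).symm (f ⊗ₜ T.map w)))) := by
  induction w using TensorProduct.induction_on with
  | zero => simp
  | add u v hu hv => simp only [TensorProduct.tmul_add, map_add, hu, hv]
  | tmul b a => exact τ.map_act f b a

/-- On `b ⊗ a`, balancing moves `b` from `fb` onto `da ⊗ 1`, where it passes `da` by the lifted
twist; that twist commutes with `d`. -/
theorem dLeft_rTensor_act (f : F) (w : B ⊗[k] A) :
    τ.dLeft E ((rAct k B F ∘ₗ TensorProduct.mk k F B f).rTensor A w) =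
      τ.cls E (0, 1 ⊗ₜ f) ((dU k A).rTensor B (T.map w), 0) := by
  induction w using TensorProduct.induction_on with
  | zero => simp [← Prod.zero_eq_mk, cls_zero_right]
  | add u v hu hv => simp only [map_add, cls_right_fst_add, hu, hv]
  | tmul b a =>
    have h : LinearMap.mul' k B ∘ₗ (TensorProduct.mk k B B).flip 1 = LinearMap.id :=
      LinearMap.ext fun b => mul_one b
    simp only [LinearMap.rTensor_tmul, LinearMap.comp_apply, TensorProduct.mk_apply, rAct_tmul,
      dLeft_tmul, cls_snd_op_smul, T.formsL_right_fst, T.omegaA_dU, h, LinearMap.lTensor_id,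
      LinearMap.id_apply]

/-- The Leibniz rule for `d ∘ σ`, written at `τ(f ⊗ a)`. The summand `(da)α` of `d(aα)` gives the
action, and `a dα` gives the tensor with the differential once `a` is balanced back through `τ`. -/
theorem dLeft_inv_twAct (f : F) (a α : A) (β : B) :
    τ.dLeft E (τ.inv (twAct (LinearMap.mul' k A) (rAct k B F) τ.map
      (τ.map (f ⊗ₜ a) ⊗ₜ (α ⊗ₜ β)))) = τ.targetAct E (α ⊗ₜ β) (τ.dLeft E (f ⊗ₜ a)) +
        τ.cls E (0, τ.map (f ⊗ₜ a)) (dU k A α ⊗ₜ β, 0) := by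
  -- Invertibility of `R` enters here: with this `w`, the product of `τ(f ⊗ a)` and `α ⊗ β` is `τ`
  -- of an explicit element, so `σ` can be evaluated on it.
  obtain ⟨w, hw⟩ : ∃ w, T.map w = (a * α) ⊗ₜ β := T.toEquiv.surjective _
  have h1 : twAct (LinearMap.mul' k A) (rAct k B F) τ.map (τ.map (f ⊗ₜ a) ⊗ₜ (α ⊗ₜ β)) =
      τ.map ((rAct k B F ∘ₗ TensorProduct.mk k F B f).rTensor A w) := by
    rw [twAct_map_tmul, map_rTensor_act, hw, TensorProduct.assoc_symm_tmul,
      LinearMap.rTensor_tmul]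
    generalize τ.map (f ⊗ₜ (a * α)) = u
    induction u using TensorProduct.induction_on with
    | zero => simp
    | add u v hu hv => simp only [TensorProduct.add_tmul, map_add, hu, hv]
    | tmul a f => simp
  have h2 := τ.cls_snd_map (E := E) 1 f a (dU k A α ⊗ₜ β, 0)
  rw [LinearMap.mulLeft_one, LinearMap.rTensor_id, LinearMap.id_apply, T.formsL_left_fst] at h2
  rw [h1, inv_map, dLeft_rTensor_act, hw, LinearMap.rTensor_tmul, dU_mul,
    TensorProduct.add_tmul, cls_right_fst_add, h2, dLeft_tmul, targetAct_cls,
    T.formsR_left_fst, T.map_one_left]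
  simp

theorem nabla₂_twAct {nablaF : F →ₗ[k] ModForms k B F}
    (hF : IsUniversalConnection nablaF) (hτ : τ.Compatible nablaF) (y : A ⊗[k] F)
    (α : A) (β : B) :
    τ.nabla₂ (E := E) nablaF (twAct (LinearMap.mul' k A) (rAct k B F) τ.map
      (y ⊗ₜ (α ⊗ₜ β))) = τ.targetAct E (α ⊗ₜ β) (τ.nabla₂ nablaF y) +
        τ.cls E (0, y) (dU k A α ⊗ₜ β, α ⊗ₜ dU k B β) := by
  have h1 : τ.inclF E (nablaF.lTensor A (twAct (LinearMap.mul' k A) (rAct k B F) τ.map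
      (y ⊗ₜ (α ⊗ₜ β)))) = τ.targetAct E (α ⊗ₜ β) (τ.inclF E (nablaF.lTensor A y)) +
        τ.cls E (0, y) (0, α ⊗ₜ dU k B β) := by
    induction y using TensorProduct.induction_on with
    | zero => simp [← Prod.zero_eq_mk, cls_zero_left]
    | add u v hu hv =>
      simp only [TensorProduct.add_tmul, map_add, cls_left_snd_add, hu, hv]
      abel
    | tmul a f => exact τ.inclF_lTensor_twAct hF hτ a f α β
  have h2 : τ.dLeft E (τ.inv (twAct (LinearMap.mul' k A) (rAct k B F) τ.map
      (y ⊗ₜ (α ⊗ₜ β)))) = τ.targetAct E (α ⊗ₜ β) (τ.dLeft E (τ.inv y)) +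
        τ.cls E (0, y) (dU k A α ⊗ₜ β, 0) := by
    clear h1
    -- Writing `y` as `τ(z)` removes `σ`; the induction then runs over `F ⊗ A`.
    obtain ⟨z, rfl⟩ := τ.map_surjective y
    rw [inv_map]
    induction z using TensorProduct.induction_on with
    | zero => simp [← Prod.zero_eq_mk, cls_zero_left]
    | add u v hu hv =>
      simp only [TensorProduct.add_tmul, map_add, cls_left_snd_add, hu, hv]
      abel
    | tmul f a => exact τ.dLeft_inv_twAct f a α β
  rw [nabla₂_apply, h1, h2, nabla₂_apply, map_add,
    τ.cls_right_split _ (dU k A α ⊗ₜ β) (α ⊗ₜ dU k B β)]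
  abel

/-- Both sides are additive in the acting element and split over the two summands of the module, so
the two Leibniz rules for `α ⊗ β` suffice. -/
theorem product_isTwConnection {nablaE : E →ₗ[k] ModForms k A E}
    {nablaF : F →ₗ[k] ModForms k B F} (hE : IsUniversalConnection nablaE)
    (hF : IsUniversalConnection nablaF) (hτ : τ.Compatible nablaF) :
    τ.IsTwConnection (τ.product nablaE nablaF) := by
  intro m s
  obtain ⟨⟨x, y⟩, rfl⟩ := (τ.pair E).surjective m
  change τ.product nablaE nablaF (τ.prodR E (τ.pair E (x, y) ⊗ₜ s)) =
    τ.targetAct E s (τ.product nablaE nablaF (τ.pair E (x, y))) +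
      τ.cls E (x, y) (T.dForms s)
  rw [prodR_tmul, product_pair, product_pair]
  induction s using TensorProduct.induction_on with
  | zero =>
    simp [Bal.act_zero, cls_zero_right]
  | add u v hu hv =>
    rw [TensorProduct.tmul_add, TensorProduct.tmul_add, map_add, map_add, map_add, map_add,
      add_add_add_comm, hu, hv, targetAct, Bal.act_add, map_add T.dForms,
      cls_add_right]
    abel
  | tmul α β =>
    have h1 : τ.nabla₁ nablaE (twAct (rAct k A E) (LinearMap.mul' k B) T.map
        (x ⊗ₜ (α ⊗ₜ β))) = τ.targetAct E (α ⊗ₜ β) (τ.nabla₁ nablaE x) +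
          τ.cls E (x, 0) (dU k A α ⊗ₜ β, α ⊗ₜ dU k B β) := by
      induction x using TensorProduct.induction_on with
      | zero => simp [← Prod.zero_eq_mk, cls_zero_left]
      | add u v hu hv =>
        simp only [TensorProduct.add_tmul, map_add, cls_left_fst_add, hu, hv]
        abel
      | tmul e b => exact τ.nabla₁_twAct hE e b α β
    have h3 : τ.cls E (x, y) (T.dForms (α ⊗ₜ β)) =
        τ.cls E (x, 0) (dU k A α ⊗ₜ β, α ⊗ₜ dU k B β) +
          τ.cls E (0, y) (dU k A α ⊗ₜ β, α ⊗ₜ dU k B β) := by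
      rw [← cls_add_left, Prod.mk_add_mk, add_zero, zero_add]
      rfl
    rw [h1, τ.nabla₂_twAct hF hτ, h3, map_add]
    abel

end ModuleTwist

/-! ### Products of connections on free modules, for a general twist. -/

section FreeProduct

variable {k : Type*} [Field k] {A B : Type*} [Ring A] [Algebra k A] [Ring B] [Algebra k B]
  {T : TwistingMap k A B}

theorem TwistingMap.pow_map_single (T : TwistingMap k A B) (n : ℕ) (l : Fin n) (b : B) (a : A) :
    (T.pow n).map (Pi.single l b ⊗ₜ a) =
      (LinearMap.single k (fun _ : Fin n => B) l).lTensor A (T.map (b ⊗ₜ a)) :=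
  powMap_single n T.map l (b ⊗ₜ a)

theorem TwistingMap.pow_inv_single (T : TwistingMap k A B) (n : ℕ) (l : Fin n) (a : A) (b : B) :
    (T.pow n).inv (a ⊗ₜ Pi.single l b) =
      (LinearMap.single k (fun _ : Fin n => B) l).rTensor A (T.toEquiv.symm (a ⊗ₜ b)) :=
  powMapInv_single n T.toEquiv.symm.toLinearMap l (a ⊗ₜ b)

theorem grassmann_single {m : ℕ} (i : Fin m) (a : A) : grassmann k A m (Pi.single i a) =
    Bal.mk (rAct k A (Fin m → A)) (omegaL k A) (Pi.single i 1 ⊗ₜ dU k A a) := by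
  rw [grassmann_apply, Finset.sum_eq_single i (fun j _ hj => by simp [hj]) (by simp),
    Pi.single_eq_same]

/-- On `f_l b` the connection gives `f_l ⊗ db`. The lifted twist moves `a` past `db` as past `b`,
and `R(1 ⊗ a) = a ⊗ 1` lets it pass the generator `f_l` unchanged. -/
theorem grassmann_compatible (T : TwistingMap k A B) (n : ℕ) :
    (T.pow n).Compatible (grassmann k B n) := by
  refine TensorProduct.ext' fun f a => ?_
  induction f using pow_induction with
  | h0 => simp
  | hadd u v hu hv => simp only [TensorProduct.add_tmul, map_add, hu, hv]
  | hs l b =>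
  simp only [LinearMap.comp_apply, LinearMap.rTensor_tmul, grassmann_single,
    ModuleTwist.pass_mk, ModuleTwist.passAux, LinearEquiv.coe_coe, TensorProduct.assoc_tmul,
    LinearMap.lTensor_tmul, T.omegaB_dU, T.pow_map_single]
  generalize T.map (b ⊗ₜ a) = u
  induction u using TensorProduct.induction_on with
  | zero => simp
  | add u v hu hv => simp only [TensorProduct.tmul_add, map_add, hu, hv]
  | tmul a b =>
    simp [T.pow_map_single, T.map_one_left, grassmann_single]

variable {m n : ℕ}

theorem product_grassmann_pair (τ : ModuleTwist T (Fin n → B)) (e : Fin m → A) (b : B) (a : A)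
    (f : Fin n → B) :
    τ.product (grassmann k A m) (grassmann k B n) (τ.pair _ (e ⊗ₜ b, a ⊗ₜ f)) =
      ∑ i : Fin m, τ.cls (Fin m → A) (Pi.single i 1 ⊗ₜ 1, 0) (dU k A (e i) ⊗ₜ b, 0) +
        τ.cls (Fin m → A) (e ⊗ₜ 1, 0) (0, 1 ⊗ₜ dU k B b) +
        ∑ l : Fin n, τ.cls (Fin m → A) (0, a ⊗ₜ Pi.single l 1) (0, 1 ⊗ₜ dU k B (f l)) +
        τ.dLeft (Fin m → A) (τ.inv (a ⊗ₜ f)) := by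
  simp only [τ.product_pair, τ.nabla₁_tmul, τ.nabla₂_apply, LinearMap.lTensor_tmul,
    grassmann_apply, TensorProduct.sum_tmul, TensorProduct.tmul_sum, map_sum, τ.inclE_mk,
    τ.inclF_mk]
  abel

/-- The product is affine in each connection, so only additivity is used: neither a Leibniz rule nor
compatibility is needed. -/
theorem product_add_potential_pair (τ : ModuleTwist T (Fin n → B))
    (nablaE : (Fin m → A) →ₗ[k] ModForms k A (Fin m → A))
    (nablaF : (Fin n → B) →ₗ[k] ModForms k B (Fin n → B))
    {s t : ℕ} (φ : Fin s → Module.End Aᵐᵒᵖ (Fin m → A)) (ω : Fin s → Omega k A)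
    (ψ : Fin t → Module.End Bᵐᵒᵖ (Fin n → B)) (η : Fin t → Omega k B)
    (e : Fin m → A) (b : B) (a : A) (f : Fin n → B) :
    τ.product (nablaE + potential φ ω) (nablaF + potential ψ η)
        (τ.pair _ (e ⊗ₜ b, a ⊗ₜ f)) =
      τ.product nablaE nablaF (τ.pair _ (e ⊗ₜ b, a ⊗ₜ f)) +
        ∑ i : Fin s, ∑ j : Fin m, τ.cls (Fin m → A)
          (φ i (Pi.single j 1) ⊗ₜ 1, 0) (omegaR k A (ω i ⊗ₜ e j) ⊗ₜ b, 0) +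
        ∑ i : Fin t, ∑ l : Fin n, τ.cls (Fin m → A)
          (0, a ⊗ₜ ψ i (Pi.single l 1)) (0, 1 ⊗ₜ omegaR k B (η i ⊗ₜ f l)) := by
  simp only [τ.product_pair, τ.nabla₁_add, τ.nabla₂_add, LinearMap.lTensor_tmul,
    LinearMap.rTensor_tmul, potential_apply, TensorProduct.sum_tmul, TensorProduct.tmul_sum,
    map_sum, τ.inclE_mk, τ.inclF_mk]
  abel

end FreeProduct

/-! ### The inverse twist of the quantum plane as a rescaling of `y`. -/

section QuantumPlane

variable {k : Type*} [Field k]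

open Polynomial in
theorem qShift_add (c : k) (u v : k[X]) : qShift c (u + v) = qShift c u + qShift c v :=
  add_comp

open Polynomial in
theorem qShift_smul (c a : k) (u : k[X]) : qShift c (a • u) = a • qShift c u :=
  Polynomial.smul_comp a u _

open Polynomial in
theorem qShift_pow (c : k) (i : ℕ) : qShift c (X ^ i) = c ^ i • (X ^ i : k[X]) := by
  rw [qShift, X_pow_comp, mul_pow, ← C_pow, smul_eq_C_mul]

open Polynomial in
theorem quantumTwist_symm (q : k) (hq : q ≠ 0) (j : ℕ) (p : k[X]) :
    (quantumTwist q hq).toEquiv.symm ((X ^ j : k[X]) ⊗ₜ p) =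
      qShift (q ^ j)⁻¹ p ⊗ₜ (X ^ j : k[X]) := by
  change qFlip q⁻¹ _ = _
  induction p using poly_induction with
  | hadd u v hu hv =>
    simp only [TensorProduct.tmul_add, TensorProduct.add_tmul, map_add, qShift_add, hu, hv]
  | hs c u hu =>
    simp only [TensorProduct.tmul_smul, ← TensorProduct.smul_tmul', map_smul, qShift_smul, hu]
  -- The scalar `(q⁻¹)^(j * i)` from the flip is the `i`-th power of `(q^j)⁻¹`, hence the effect of
  -- rescaling the variable in `X ^ i`.
  | hX i => rw [qFlip_pow, qShift_pow, ← inv_pow, ← pow_mul, TensorProduct.smul_tmul']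

open Polynomial in
theorem quantumModuleTwist_inv (q : k) (hq : q ≠ 0) (n j : ℕ) (f : Fin n → k[X]) :
    (quantumModuleTwist q hq n).inv ((X ^ j : k[X]) ⊗ₜ f) =
      (fun l => qShift (q ^ j)⁻¹ (f l)) ⊗ₜ (X ^ j : k[X]) := by
  induction f using pow_induction with
  | h0 =>
    have h : (fun _ : Fin n => qShift (q ^ j)⁻¹ (0 : k[X])) = 0 := by
      ext1 l
      simp [qShift]
    simp [h]
  | hadd u v hu hv =>
    rw [TensorProduct.tmul_add, map_add, hu, hv, ← TensorProduct.add_tmul]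
    congr 1
    ext1 l
    exact (qShift_add _ _ _).symm
  | hs l p =>
    rw [quantumModuleTwist, TwistingMap.pow_inv_single, quantumTwist_symm, LinearMap.rTensor_tmul]
    congr 1
    ext1 i
    rw [LinearMap.single_apply]
    -- Off the component `l` both entries vanish, since the shift of `0` is `0`.
    rcases eq_or_ne i l with rfl | h
    · simp
    · simp [h, qShift]

end QuantumPlane
end ProdConn

theorem mainTheorem5 {k : Type*} [Field k] (q : k) (hq : q ≠ 0) (m n : ℕ) :
    -- the Grassmann connections on `E = A^m` and `F = B^n`, for `A = k[x]` and `B = k[y]`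
    IsUniversalConnection (grassmann k k[X] m) ∧
    IsUniversalConnection (grassmann k k[X] n) ∧
    (quantumModuleTwist q hq n).Compatible (grassmann k k[X] n) ∧
    -- their product
    (∀ (e : Fin m → k[X]) (b : k[X]) (j : ℕ) (f : Fin n → k[X]),
      (quantumModuleTwist q hq n).product (grassmann k k[X] m) (grassmann k k[X] n)
          ((quantumModuleTwist q hq n).pair _ (e ⊗ₜ b, (Polynomial.X ^ j) ⊗ₜ f)) =
        ∑ i : Fin m, (quantumModuleTwist q hq n).cls (Fin m → k[X])
            (Pi.single i 1 ⊗ₜ 1, 0) (dU k k[X] (e i) ⊗ₜ b, 0) +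
          (quantumModuleTwist q hq n).cls (Fin m → k[X])
            (e ⊗ₜ 1, 0) (0, 1 ⊗ₜ dU k k[X] b) +
          ∑ l : Fin n, (quantumModuleTwist q hq n).cls (Fin m → k[X])
            (0, (Polynomial.X ^ j) ⊗ₜ Pi.single l 1) (0, 1 ⊗ₜ dU k k[X] (f l)) +
          (quantumModuleTwist q hq n).cls (Fin m → k[X])
            (0, 1 ⊗ₜ fun l => qShift (q ^ j)⁻¹ (f l))
            (dU k k[X] (Polynomial.X ^ j) ⊗ₜ 1, 0)) ∧
    -- the same on the generators `x ⊗ (y^{i₁}, …, y^{iₙ})`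
    (∀ (e : Fin m → k[X]) (b : k[X]) (p : Fin n → ℕ),
      (quantumModuleTwist q hq n).product (grassmann k k[X] m) (grassmann k k[X] n)
          ((quantumModuleTwist q hq n).pair _
            (e ⊗ₜ b, Polynomial.X ⊗ₜ fun l => Polynomial.X ^ p l)) =
        ∑ i : Fin m, (quantumModuleTwist q hq n).cls (Fin m → k[X])
            (Pi.single i 1 ⊗ₜ 1, 0) (dU k k[X] (e i) ⊗ₜ b, 0) +
          (quantumModuleTwist q hq n).cls (Fin m → k[X])
            (e ⊗ₜ 1, 0) (0, 1 ⊗ₜ dU k k[X] b) +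
          ∑ l : Fin n, (quantumModuleTwist q hq n).cls (Fin m → k[X])
            (0, Polynomial.X ⊗ₜ Pi.single l 1) (0, 1 ⊗ₜ dU k k[X] (Polynomial.X ^ p l)) +
          (quantumModuleTwist q hq n).cls (Fin m → k[X])
            (0, 1 ⊗ₜ fun l => (q ^ p l)⁻¹ • Polynomial.X ^ p l)
            (dU k k[X] Polynomial.X ⊗ₜ 1, 0)) ∧
    -- adding any gauge potential to a Grassmann connection gives a connection
    (∀ (s : ℕ) (φ : Fin s → Module.End k[X]ᵐᵒᵖ (Fin m → k[X])) (ω : Fin s → Omega k k[X]),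
      IsUniversalConnection (grassmann k k[X] m + potential φ ω)) ∧
    (∀ (t : ℕ) (ψ : Fin t → Module.End k[X]ᵐᵒᵖ (Fin n → k[X])) (η : Fin t → Omega k k[X]),
      IsUniversalConnection (grassmann k k[X] n + potential ψ η)) ∧
    -- arbitrary connections on `E` and `F`, and their product
    (∀ (nablaE : (Fin m → k[X]) →ₗ[k] ModForms k k[X] (Fin m → k[X]))
       (nablaF : (Fin n → k[X]) →ₗ[k] ModForms k k[X] (Fin n → k[X])),
      IsUniversalConnection nablaE → IsUniversalConnection nablaF →
      (∃ (s : ℕ) (φ : Fin s → Module.End k[X]ᵐᵒᵖ (Fin m → k[X])) (ω : Fin s → Omega k k[X]),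
        nablaE = grassmann k k[X] m + potential φ ω) ∧
      (∃ (t : ℕ) (ψ : Fin t → Module.End k[X]ᵐᵒᵖ (Fin n → k[X])) (η : Fin t → Omega k k[X]),
        nablaF = grassmann k k[X] n + potential ψ η) ∧
      ((quantumModuleTwist q hq n).Compatible nablaF →
        (quantumModuleTwist q hq n).IsTwConnection
          ((quantumModuleTwist q hq n).product nablaE nablaF)) ∧
      (∀ (s : ℕ) (φ : Fin s → Module.End k[X]ᵐᵒᵖ (Fin m → k[X])) (ω : Fin s → Omega k k[X])
         (t : ℕ) (ψ : Fin t → Module.End k[X]ᵐᵒᵖ (Fin n → k[X])) (η : Fin t → Omega k k[X]),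
        nablaE = grassmann k k[X] m + potential φ ω →
        nablaF = grassmann k k[X] n + potential ψ η →
        ∀ (e : Fin m → k[X]) (b a : k[X]) (f : Fin n → k[X]),
          (quantumModuleTwist q hq n).product nablaE nablaF
              ((quantumModuleTwist q hq n).pair _ (e ⊗ₜ b, a ⊗ₜ f)) =
            (quantumModuleTwist q hq n).product (grassmann k k[X] m) (grassmann k k[X] n)
              ((quantumModuleTwist q hq n).pair _ (e ⊗ₜ b, a ⊗ₜ f)) +
            ∑ i : Fin s, ∑ j : Fin m, (quantumModuleTwist q hq n).cls (Fin m → k[X])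
              (φ i (Pi.single j 1) ⊗ₜ 1, 0) (omegaR k k[X] (ω i ⊗ₜ e j) ⊗ₜ b, 0) +
            ∑ i : Fin t, ∑ l : Fin n, (quantumModuleTwist q hq n).cls (Fin m → k[X])
              (0, a ⊗ₜ ψ i (Pi.single l 1)) (0, 1 ⊗ₜ omegaR k k[X] (η i ⊗ₜ f l)))) := by
  refine ⟨grassmann_isUniversalConnection m, grassmann_isUniversalConnection n,
    grassmann_compatible (quantumTwist q hq) n, fun e b j f => ?_, fun e b p => ?_,
    fun s φ ω => grassmann_add_potential_isUniversalConnection φ ω,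
    fun t ψ η => grassmann_add_potential_isUniversalConnection ψ η,
    fun nablaE nablaF hE hF => ⟨exists_eq_grassmann_add_potential hE,
      exists_eq_grassmann_add_potential hF, fun hτ => ModuleTwist.product_isTwConnection _ hE hF hτ,
      ?_⟩⟩
  · rw [product_grassmann_pair, quantumModuleTwist_inv, ModuleTwist.dLeft_tmul]
  -- The case `j = 1`: on the monomial `X ^ p l`, rescaling by `q⁻¹` is multiplication by `(q ^ p
  -- l)⁻¹`.
  · have h := quantumModuleTwist_inv q hq n 1 fun l => Polynomial.X ^ p l
    simp only [pow_one, qShift_pow, inv_pow] at h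
    rw [product_grassmann_pair, h, ModuleTwist.dLeft_tmul]
  · rintro s φ ω t ψ η rfl rfl e b a f
    exact product_add_potential_pair _ _ _ φ ω ψ η e b a f
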